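/- Let $\Bbbk$ be a field and let $K$ be a finite (abstract) simplicial complex of dimension $d$, with $\#K$ simplices. A filter function is a map $f:K\to\mathbb{R}$ with $f(\sigma)\le f(\sigma')$ whenever $\sigma\subseteq\sigma'$. For $0\le p\le d$ let $\mathrm{Dgm}_p(f)$ be the persistence diagram of the persistence module $t\mapsto H_p(\{\sigma\in K: f(\sigma)\le t\};\Bbbk)$, that is, the finite multiset of the points $(\inf J,\sup J)\in\mathbb{R}\times(\mathbb{R}\cup\{+\infty\})$, for $J$ ranging over the intervals of its interval decomposition, together with countably many copies of the diagonal. The bottleneck distance $d_B(D,D')$ is the infimum, over all bijections $\gamma:D\to D'$ of multisets, of $\sup_{x\in D}\|x-\gamma(x)\|_\infty$. Two filter functions are ordering equivalent if they induce the same pre-order on the simplices of $K$; the equivalence classes are called strata, and a stratum is top-dimensional if its dimension (that of its affine span in $\mathbb{R}^K$) is $\#K$. Put $$d_0(f)=\tfrac12\min_{\sigma\ne\sigma'}|f(\sigma)-f(\sigma')|$$ (with $\min\emptyset=+\infty$). (1) Let $f,g\in\mathbb{R}^K$ be filter functions that lie in the closure of a common top-dimensional stratum $S$. Then $$\max_{0\le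 p\le d} d_B(\mathrm{Dgm}_p(f),\mathrm{Dgm}_p(g))\ \ge\ \min\bigl(\|f-g\|_\infty,\ \max(d_0(f),d_0(g))\bigr).$$ (2) Let $f$ be a filter function that lies in a top-dimensional stratum. For every $g\in\mathbb{R}^K$ with $\|f-g\|_\infty\le d_0(f)$, $g$ is a filter function and $$\max_{0\le p\le d} d_B(\mathrm{Dgm}_p(f),\mathrm{Dgm}_p(g))=\|f-g\|_\infty .$$ (3) Let $f$ be a filter function that lies in a top-dimensional stratum. For all $g,h\in\mathbb{R}^K$ with $\max(\|f-g\|_\infty,\|f-h\|_\infty)\le d_0(f)/3$, $g$ and $h$ are filter functions and $$\max_{0\le p\le d} d_B(\mathrm{Dgm}_p(g),\mathrm{Dgm}_p(h))=\|g-h\|_\infty .$$ -/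

import Mathlib

open scoped ENNReal

noncomputable section

namespace Persistence

/-! ## Persistence modules and interval decompositions -/

/-- A persistence module over the field `k`: a functor from `(ℝ, ≤)` to `k`-vector spaces,
written out as spaces `V_t` and linear maps `v_{s,t} : V_s → V_t` for `s ≤ t`. -/
structure PersistenceModule (k : Type*) [Field k] where
  space : ℝ → Type*
  [addCommGroup : ∀ t, AddCommGroup (space t)]
  [module : ∀ t, Module k (space t)]
  map : ∀ {s t : ℝ}, s ≤ t → space s →ₗ[k] space t
  map_refl : ∀ (t : ℝ) (x : space t), map (le_refl t) x = x
  map_comp : ∀ {r s t : ℝ} (hrs : r ≤ s) (hst : s ≤ t) (x : space r),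
    map hst (map hrs x) = map (hrs.trans hst) x

attribute [instance] PersistenceModule.addCommGroup PersistenceModule.module

/-- Two persistence modules are isomorphic if there are linear isomorphisms `V_t ≃ W_t`
commuting with the structure maps. -/
def PersistenceModule.IsIso {k : Type*} [Field k] (V W : PersistenceModule k) : Prop :=
  ∃ e : ∀ t, V.space t ≃ₗ[k] W.space t,
    ∀ (s t : ℝ) (h : s ≤ t) (x : V.space s), e t (V.map h x) = W.map h (e s x)

/-- A (nonempty) interval of the real line, of any kind (open, half-open, closed, unbounded). -/
structure RealInterval where
  carrier : Set ℝ
  nonempty : carrier.Nonempty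
  ordConnected : carrier.OrdConnected

open Classical in
/-- The space at `t` of the interval module of `J`: `k` if `t ∈ J` and `0` otherwise. -/
def intervalSpace (k : Type*) [Field k] (J : RealInterval) (t : ℝ) : Submodule k k :=
  if t ∈ J.carrier then ⊤ else ⊥

theorem mem_intervalSpace {k : Type*} [Field k] {J : RealInterval} {t : ℝ} {x : k} :
    x ∈ intervalSpace k J t ↔ (t ∉ J.carrier → x = 0) := by
  by_cases h : t ∈ J.carrier <;> simp [intervalSpace, h]

open Classical in
/-- The interval module of `J`: the space at `t` is `k` if `t ∈ J` and `0` otherwise; the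
structure maps are the identity between points of `J` and `0` otherwise. -/
def intervalModule (k : Type*) [Field k] (J : RealInterval) : PersistenceModule k where
  space t := intervalSpace k J t
  map {s t} _ :=
    { toFun := fun x => ⟨if t ∈ J.carrier then (x : k) else 0,
        mem_intervalSpace.2 fun h => if_neg h⟩
      map_add' := fun x y => by ext; dsimp; split_ifs <;> simp
      map_smul' := fun c x => by ext; dsimp; split_ifs <;> simp }
  map_refl t x := by
    apply Subtype.ext
    by_cases h : t ∈ J.carrier
    · exact if_pos h
    · exact (if_neg h).trans (mem_intervalSpace.1 x.2 h).symm
  map_comp {r s t} hrs hst x := by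
    apply Subtype.ext
    by_cases ht : t ∈ J.carrier
    · by_cases hs : s ∈ J.carrier
      · simp [ht, hs]
      · have hr : r ∉ J.carrier := fun hr => hs (J.ordConnected.out hr ht ⟨hrs, hst⟩)
        simp [ht, hs, mem_intervalSpace.1 x.2 hr]
    · simp [ht]

/-- The direct sum of finitely many persistence modules, formed pointwise. -/
def directSum {k : Type*} [Field k] {n : ℕ} (V : Fin n → PersistenceModule k) :
    PersistenceModule k where
  space t := ∀ i, (V i).space t
  map h := LinearMap.pi fun i => ((V i).map h).comp (LinearMap.proj i)
  map_refl t x := by ext i; simp [(V i).map_refl]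
  map_comp hrs hst x := by ext i; simp [(V i).map_comp]

/-- The finite multiset `B` of intervals decomposes `V`: `V` is isomorphic to the direct sum of the
interval modules of the members of `B`. -/
def IsBarcode {k : Type*} [Field k] (V : PersistenceModule k) (B : Multiset RealInterval) : Prop :=
  ∃ (n : ℕ) (J : Fin n → RealInterval),
    Multiset.map J Finset.univ.val = B ∧ V.IsIso (directSum fun i => intervalModule k (J i))

open Classical in
/-- The barcode of a persistence module of finite type, i.e. the multiset of intervals of an
interval decomposition (the empty multiset if `V` is not of finite type). -/
def barcode {k : Type*} [Field k] (V : PersistenceModule k) : Multiset RealInterval :=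
  if h : ∃ B, IsBarcode V B then h.choose else 0

/-! ## Persistence diagrams and the bottleneck distance -/

open Classical in
/-- The point `(inf J, sup J)` of `ℝ × (ℝ ∪ {+∞})` (meant for `J` bounded below). -/
def endpoints (J : RealInterval) : ℝ × WithTop ℝ :=
  (sInf J.carrier, if BddAbove J.carrier then ((sSup J.carrier : ℝ) : WithTop ℝ) else ⊤)

/-- A persistence diagram `B ∪ Δ^∞` is recorded by the finite multiset `B` of points of
`ℝ × (ℝ ∪ {+∞})`; the diagonal is added in `Diagram.Point`. -/
abbrev Diagram : Type := Multiset (ℝ × WithTop ℝ)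

/-- The elements, counted with multiplicity, of the multiset `B ∪ Δ^∞`: those of `B`, and countably
many copies `(b, i)`, `i ∈ ℕ`, of each diagonal point `(b, b)`. -/
def Diagram.Point (D : Diagram) : Type := D.ToType ⊕ (ℝ × ℕ)

/-- The location in the extended plane of an element of a persistence diagram. -/
def Diagram.Point.loc {D : Diagram} : D.Point → ℝ × WithTop ℝ
  | Sum.inl x => x.1
  | Sum.inr y => (y.1, ((y.1 : ℝ) : WithTop ℝ))

/-- The distance `|x - y|` on `ℝ ∪ {+∞}`, with `|∞ - ∞| = 0` and `|∞ - x| = ∞` for `x` real. -/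
def extDist : WithTop ℝ → WithTop ℝ → ℝ≥0∞
  | some x, some y => edist x y
  | none, none => 0
  | _, _ => ∞

/-- The `ℓ^∞` distance on `ℝ × (ℝ ∪ {+∞})`. -/
def planeDist (x y : ℝ × WithTop ℝ) : ℝ≥0∞ := max (edist x.1 y.1) (extDist x.2 y.2)

/-- The bottleneck distance: the infimum over all matchings (bijections between the two diagrams,
diagonal included) of the largest displacement. -/
def bottleneckDist (D D' : Diagram) : ℝ≥0∞ :=
  ⨅ γ : D.Point ≃ D'.Point, ⨆ x : D.Point, planeDist x.loc (γ x).loc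

/-! ## Simplicial homology

The vertex type is linearly ordered, which orients all simplices. -/

section Homology

variable (k : Type*) [Field k] {V : Type*}

/-- The space of formal finite linear combinations of finite sets of vertices; it contains the
chains of all complexes on the vertex set `V`. -/
def ChainSpace (k : Type*) [Field k] (V : Type*) : Type _ := Finset V →₀ k

instance (k : Type*) [Field k] (V : Type*) : AddCommGroup (ChainSpace k V) :=
  inferInstanceAs (AddCommGroup (Finset V →₀ k))

instance (k : Type*) [Field k] (V : Type*) : Module k (ChainSpace k V) :=
  inferInstanceAs (Module k (Finset V →₀ k))

/-- The set of vertices `σ`, as a basis element of the space of chains. -/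
def simplexChain (σ : Finset V) : ChainSpace k V := Finsupp.single σ (1 : k)

/-- The `p`-chains of `L`: formal combinations of the `p`-simplices of `L`. -/
def chains (p : ℕ) (L : PreAbstractSimplicialComplex V) : Submodule k (ChainSpace k V) :=
  Submodule.span k (simplexChain k '' {σ | σ ∈ L.faces ∧ σ.card = p + 1})

variable {k} in
theorem chains_mono (p : ℕ) {L M : PreAbstractSimplicialComplex V} (h : L ≤ M) :
    chains k p L ≤ chains k p M :=
  Submodule.span_mono (Set.image_mono fun _ hσ => ⟨h hσ.1, hσ.2⟩)

variable [LinearOrder V]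

/-- The simplicial boundary `∂ [v_0, …, v_p] = ∑ (-1)^i [v_0, …, v̂_i, …, v_p]` for `v_0 < ⋯ < v_p`
and `p ≥ 1`; the boundary of a vertex is `0` (homology is not reduced). -/
def boundary : ChainSpace k V →ₗ[k] ChainSpace k V :=
  Finsupp.linearCombination k fun σ : Finset V =>
    if 2 ≤ σ.card then
      ∑ v ∈ σ, (-1 : k) ^ (σ.filter (· < v)).card • simplexChain k (σ.erase v)
    else 0

/-- The `p`-cycles of `L`. -/
def cycles (p : ℕ) (L : PreAbstractSimplicialComplex V) : Submodule k (ChainSpace k V) :=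
  chains k p L ⊓ LinearMap.ker (boundary k)

/-- The `p`-boundaries of `L`. -/
def boundaries (p : ℕ) (L : PreAbstractSimplicialComplex V) : Submodule k (ChainSpace k V) :=
  (chains k (p + 1) L).map (boundary k)

variable {k} in
theorem cycles_mono (p : ℕ) {L M : PreAbstractSimplicialComplex V} (h : L ≤ M) :
    cycles k p L ≤ cycles k p M :=
  inf_le_inf_right _ (chains_mono p h)

/-- The simplicial homology `H_p(L; k)`: cycles modulo boundaries. -/
abbrev Homology (p : ℕ) (L : PreAbstractSimplicialComplex V) : Type _ :=
  cycles k p L ⧸ (boundaries k p L).submoduleOf (cycles k p L)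

/-- The map `H_p(L; k) → H_p(M; k)` induced by an inclusion `L ⊆ M`. -/
def homologyMap (p : ℕ) {L M : PreAbstractSimplicialComplex V} (h : L ≤ M) :
    Homology k p L →ₗ[k] Homology k p M :=
  Submodule.mapQ _ _ (Submodule.inclusion (cycles_mono p h))
    fun _ hx => Submodule.map_mono (chains_mono (p + 1) h) hx

end Homology

/-! ## Filter functions, their diagrams and the ordering strata -/

section FilterFunction

variable {V : Type*} (K : PreAbstractSimplicialComplex V)

/-- Filter functions are the functions on the simplices that are monotone for inclusion. -/
def IsFilterFunction {K : PreAbstractSimplicialComplex V} (f : K.faces → ℝ) : Prop :=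
  ∀ σ τ : K.faces, σ.1 ⊆ τ.1 → f σ ≤ f τ

/-- The type of filter functions on `K`. -/
abbrev FilterFunction : Type _ := {f : K.faces → ℝ // IsFilterFunction f}

variable {K}

/-- The sublevel complex `K^t = {σ ∈ K | f σ ≤ t}`. -/
def sublevel (f : FilterFunction K) (t : ℝ) : PreAbstractSimplicialComplex V where
  faces := {σ | ∃ h : σ ∈ K.faces, f.1 ⟨σ, h⟩ ≤ t}
  isRelLowerSet_faces := fun σ ⟨h, ht⟩ => ⟨(K.isRelLowerSet_faces h).1, fun τ hτσ hτ =>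
    ⟨(K.isRelLowerSet_faces h).2 hτσ hτ, (f.2 ⟨τ, _⟩ ⟨σ, h⟩ hτσ).trans ht⟩⟩

theorem sublevel_mono (f : FilterFunction K) {s t : ℝ} (h : s ≤ t) :
    sublevel f s ≤ sublevel f t :=
  fun _ ⟨hσ, hs⟩ => ⟨hσ, hs.trans h⟩

/-- The sublevel set persistent homology of `f` in degree `p`. -/
def persistentHomology (k : Type*) [Field k] [LinearOrder V] (p : ℕ) (f : FilterFunction K) :
    PersistenceModule k where
  space t := Homology k p (sublevel f t)
  map h := homologyMap k p (sublevel_mono f h)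
  map_refl t x := by
    induction x using Submodule.Quotient.induction_on with
    | _ x => rfl
  map_comp hrs hst x := by
    induction x using Submodule.Quotient.induction_on with
    | _ x => rfl

/-- The persistence diagram `Dgm_p(f)`. -/
def dgm (k : Type*) [Field k] [LinearOrder V] (p : ℕ) (f : FilterFunction K) : Diagram :=
  (barcode (persistentHomology k p f)).map endpoints

/-- The dimension of a finite simplicial complex: the largest dimension of its simplices. -/
def dim (K : PreAbstractSimplicialComplex V) [Fintype K.faces] : ℕ :=
  Finset.univ.sup fun σ : K.faces => σ.1.card - 1

/-- `max_{0 ≤ p ≤ d} d_B(Dgm_p(f), Dgm_p(g))`, where `d` is the dimension of `K`. -/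
def maxBottleneckDist (k : Type*) [Field k] [LinearOrder V] [Fintype K.faces]
    (f g : FilterFunction K) : ℝ≥0∞ :=
  (Finset.range (dim K + 1)).sup fun p => bottleneckDist (dgm k p f) (dgm k p g)

/-- The equivalence class of `f`: the filter functions that induce the same pre-order as `f`
on the simplices of `K`. -/
def orderingClass (f : FilterFunction K) : Set (K.faces → ℝ) :=
  {g | IsFilterFunction g ∧ ∀ σ τ, g σ ≤ g τ ↔ f.1 σ ≤ f.1 τ}

variable (K) in
/-- The set `Ω(ℝ^K)` of ordering equivalence classes. -/
def orderingStrata : Set (Set (K.faces → ℝ)) := Set.range orderingClass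

/-- A subset of `ℝ^K` (here a stratum, i.e. a relatively open polyhedron) is top-dimensional if its
affine span has dimension `#K`. -/
def IsTopDimensional [Fintype K.faces] (S : Set (K.faces → ℝ)) : Prop :=
  Module.finrank ℝ (vectorSpan ℝ S) = Fintype.card K.faces

/-- `d_0(f) = (1/2) min_{σ ≠ τ} |f(σ) - f(τ)|` (equal to `∞` if `K` has fewer than two simplices). -/
def d0 (f : K.faces → ℝ) : ℝ≥0∞ := (⨅ (σ) (τ) (_ : σ ≠ τ), edist (f σ) (f τ)) / 2

end FilterFunction

end Persistence

end

/-! A top-dimensional stratum is the class of an injective filter function `f₀`, since a tie would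
confine the class to a hyperplane. Every function in the closure of the stratum is weakly monotone
for the total order defined by `f₀`. Matrix reduction along this order gives a basis of the chains
of `K`, triangular for the order, in which each boundary is zero or another basis element, together
with a pairing of simplices (`exists_isAdaptedBasis`). Sublevel complexes of any weakly monotone `f`
are initial segments of the order, so this single basis decomposes the homology of all such `f`. The
diagram of `f` consists of the points `(f i, f j)` for pairs and `(f i, ∞)` for unpaired `i`, with
those on the diagonal dropped (`dgm_eq`).

Two such functions thus have diagrams with a common index set. Matching equal indices shows that the
distance is at most `‖f - g‖` (`maxBottleneckDist_le`). Conversely, every point of the diagram of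
`f` has distance at least `d0 f` from the diagonal. A matching of cost below `m ≤ d0 f` therefore
sends off-diagonal points to off-diagonal points. Reading births and deaths separately turns it into
an injection `π` of the set of simplices with `|f i - g (π i)| < m` for all `i`
(`exists_injective_edist_lt`). As `f` and `g` are sorted alike, the identity is no worse than `π`
(`exists_edist_le_of_injective`), so `‖f - g‖ < m`. Taking `m = min ‖f - g‖ (d0 f)` gives a
contradiction, and symmetry gives the maximum in (1).

For (2) and (3), a perturbation of size at most `d0 f` cannot reverse the order of two values, so
the same basis still applies. In (3) the gaps of `g` remain large enough that `‖g - h‖ ≤ d0 g`. -/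

namespace Persistence

/-! ## Reduced bases of filtered complexes -/

section ReducedBasis

variable {k : Type*} [Field k] {ι : Type*}

/-- The chain `x` is homogeneous and `i` is the last index in its support, with respect to the
ranking `r`. -/
def LeadsAt (r : ι → ℝ) (deg : ι → ℕ) (x : ι →₀ k) (i : ι) : Prop :=
  x i ≠ 0 ∧ ∀ j, x j ≠ 0 → r j ≤ r i ∧ deg j = deg i

theorem exists_leadsAt (r : ι → ℝ) {deg : ι → ℕ} {x : ι →₀ k} (hx : x ≠ 0) {p : ℕ}
    (hp : ∀ j, x j ≠ 0 → deg j = p) : ∃ i, LeadsAt r deg x i := by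
  obtain ⟨i, hi, hmax⟩ := Finset.exists_max_image x.support r (Finsupp.support_nonempty_iff.2 hx)
  rw [Finsupp.mem_support_iff] at hi
  exact ⟨i, hi, fun j hj => ⟨hmax j (Finsupp.mem_support_iff.2 hj), (hp j hj).trans (hp i hi).symm⟩⟩

theorem leadsAt_single (r : ι → ℝ) (deg : ι → ℕ) (i : ι) :
    LeadsAt r deg (Finsupp.single i (1 : k)) i := by
  classical
  refine ⟨by simp, fun j hj => ?_⟩
  rw [Finsupp.single_apply] at hj
  obtain rfl : i = j := by by_contra h; simp [h] at hj
  exact ⟨le_rfl, rfl⟩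

/-- A differential that strictly lowers the rank and lowers the degree by one. -/
structure IsFilteredDifferential (r : ι → ℝ) (deg : ι → ℕ) (d : (ι →₀ k) →ₗ[k] (ι →₀ k)) :
    Prop where
  comp_self : ∀ x, d (d x) = 0
  single : ∀ i j, d (Finsupp.single i 1) j ≠ 0 → r j < r i ∧ deg j + 1 = deg i

variable {r : ι → ℝ} {deg : ι → ℕ} {d : (ι →₀ k) →ₗ[k] (ι →₀ k)}

theorem IsFilteredDifferential.exists_of_apply_ne_zero (hd : IsFilteredDifferential r deg d)
    {x : ι →₀ k} {j : ι} (h : d x j ≠ 0) : ∃ i, x i ≠ 0 ∧ r j < r i ∧ deg j + 1 = deg i := by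
  by_contra! hc
  apply h
  rw [← Finsupp.sum_single x, Finsupp.sum, map_sum, Finsupp.finsetSum_apply]
  refine Finset.sum_eq_zero fun i hi => ?_
  by_contra hne
  have h1 : d (Finsupp.single i 1) j ≠ 0 := by
    intro h0
    apply hne
    rw [← mul_one (x i), ← smul_eq_mul, ← Finsupp.smul_single, map_smul, Finsupp.smul_apply, h0,
      smul_zero]
  exact hc i (Finsupp.mem_support_iff.1 hi) (hd.single i j h1).1 (hd.single i j h1).2

theorem LeadsAt.of_apply_ne_zero (hd : IsFilteredDifferential r deg d) {x : ι →₀ k} {i j : ι}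
    (hx : LeadsAt r deg x i) (h : d x j ≠ 0) : r j < r i ∧ deg j + 1 = deg i := by
  obtain ⟨l, hl, h1, h2⟩ := hd.exists_of_apply_ne_zero h
  exact ⟨h1.trans_le (hx.2 l hl).1, h2.trans (hx.2 l hl).2⟩

theorem LeadsAt.exists_leadsAt_map (hd : IsFilteredDifferential r deg d) {x : ι →₀ k} {i : ι}
    (hx : LeadsAt r deg x i) (h : d x ≠ 0) : ∃ j, LeadsAt r deg (d x) j :=
  exists_leadsAt r h (p := deg i - 1) fun j hj => by
    have := (hx.of_apply_ne_zero hd hj).2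
    omega

/-- A basis of a filtered complex which is triangular with respect to the filtration and in which
the differential of each element is zero or again an element of the basis. The pairing sends `j`
to the index of the differential of the `j`-th element. -/
structure IsReducedBasis (r : ι → ℝ) (deg : ι → ℕ) (d : (ι →₀ k) →ₗ[k] (ι →₀ k))
    (e : ι → ι →₀ k) (pair : ι → Option ι) : Prop where
  leadsAt : ∀ i, LeadsAt r deg (e i) i
  map_eq_zero : ∀ j, pair j = none → d (e j) = 0
  map_eq : ∀ j i, pair j = some i → d (e j) = e i
  inj : ∀ j j' i, pair j = some i → pair j' = some i → j = j'
  pair_eq_none : ∀ j i, pair j = some i → pair i = none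
  rank_lt : ∀ j i, pair j = some i → r i < r j
  deg_eq : ∀ j i, pair j = some i → deg i + 1 = deg j

/-- This is the persistence algorithm, phrased through extremal choices instead of column
operations. Each index that leads no cycle receives a chain whose differential leads as early as
possible; minimality makes these leading indices distinct. -/
theorem exists_isReducedBasis [Finite ι] (hr : Function.Injective r)
    (hd : IsFilteredDifferential r deg d) : ∃ e pair, IsReducedBasis r deg d e pair := by
  classical
  -- `Cyc` singles out the positive (birth) simplices, the others being negative (death) simplices.
  let Cyc : ι → Prop := fun i => ∃ x, LeadsAt r deg x i ∧ d x = 0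
  have h1 : ∀ j, ∃ (x : ι →₀ k) (i : ι), ¬ Cyc j → LeadsAt r deg x j ∧ LeadsAt r deg (d x) i ∧
      ∀ y l, LeadsAt r deg y j → LeadsAt r deg (d y) l → r i ≤ r l := by
    intro j
    by_cases hj : Cyc j
    · exact ⟨0, j, fun h => absurd hj h⟩
    have hne : {i | ∃ x, LeadsAt r deg x j ∧ LeadsAt r deg (d x) i}.Nonempty := by
      have hs := leadsAt_single (k := k) r deg j
      obtain ⟨i, hi⟩ := hs.exists_leadsAt_map hd fun h0 => hj ⟨_, hs, h0⟩
      exact ⟨i, _, hs, hi⟩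
    obtain ⟨i, ⟨x, hx, hi⟩, hmin⟩ := Set.exists_min_image _ r (Set.toFinite _) hne
    exact ⟨x, i, fun _ => ⟨hx, hi, fun y l hy hl => hmin l ⟨y, hy, hl⟩⟩⟩
  choose X P hXP using h1
  have hcycP : ∀ j, ¬ Cyc j → Cyc (P j) := fun j hj => ⟨_, (hXP j hj).2.1, hd.comp_self _⟩
  have hlt : ∀ j, ¬ Cyc j → r (P j) < r j ∧ deg (P j) + 1 = deg j := fun j hj =>
    (hXP j hj).1.of_apply_ne_zero hd (hXP j hj).2.1.1
  have key : ∀ j j', ¬ Cyc j → ¬ Cyc j' → P j = P j' → ¬ r j < r j' := by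
    intro j j' hj hj' hP hlt'
    obtain ⟨hx, hdx, -⟩ := hXP j hj
    obtain ⟨hx', hdx', hmin⟩ := hXP j' hj'
    -- The multiple of `X j` that cancels the common leading term of the two differentials. The
    -- difference `y` still leads at `j'`, but its differential vanishes or leads strictly earlier,
    -- against the choice of `X j'`.
    set c := d (X j') (P j) / d (X j) (P j) with hc
    set y := X j' - c • X j with hy
    have hdeg : deg j = deg j' := by rw [← (hlt j hj).2, ← (hlt j' hj').2, hP]
    have hyl : LeadsAt r deg y j' := by
      constructor
      · have : X j j' = 0 := by
          by_contra h0
          exact absurd (hx.2 _ h0).1 (not_le.2 hlt')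
        simpa [hy, this] using hx'.1
      · intro l hl
        by_cases h0 : X j l = 0
        · exact hx'.2 l (by simpa [hy, h0] using hl)
        · exact ⟨(hx.2 l h0).1.trans hlt'.le, (hx.2 l h0).2.trans hdeg⟩
    have hdy : d y = d (X j') - c • d (X j) := by simp [hy]
    have hdyP : d y (P j) = 0 := by
      rw [hdy]
      simp [hc, div_mul_cancel₀ _ hdx.1]
    obtain ⟨l, hl⟩ := hyl.exists_leadsAt_map hd fun h0 => hj' ⟨y, hyl, h0⟩
    have hle : r l ≤ r (P j) := by
      by_cases h0 : d (X j) l = 0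
      · rw [hP]
        refine (hdx'.2 l ?_).1
        have := hl.1
        rw [hdy] at this
        simpa [h0] using this
      · exact (hdx.2 l h0).1
    have : l = P j := hr (le_antisymm hle (hP ▸ hmin y l hyl hl))
    exact hl.1 (this ▸ hdyP)
  have hinj : ∀ j j', ¬ Cyc j → ¬ Cyc j' → P j = P j' → j = j' := fun j j' hj hj' hP =>
    hr (le_antisymm (not_lt.1 (key j' j hj' hj hP.symm)) (not_lt.1 (key j j' hj hj' hP)))
  -- Three kinds of basis elements: `X i` for a death, `d (X j)` for a birth killed by `j`, and any
  -- cycle leading at `i` for an essential birth.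
  have h2 : ∀ i, ∃ x, LeadsAt r deg x i ∧ (¬ Cyc i → x = X i) ∧ (Cyc i → d x = 0) ∧
      ∀ j, ¬ Cyc j → P j = i → x = d (X j) := by
    intro i
    by_cases hi : Cyc i
    · by_cases hj : ∃ j, ¬ Cyc j ∧ P j = i
      · obtain ⟨j, hj, hji⟩ := hj
        refine ⟨d (X j), hji ▸ (hXP j hj).2.1, fun h => absurd hi h, fun _ => hd.comp_self _,
          fun j' hj' hji' => ?_⟩
        rw [hinj j j' hj hj' (hji.trans hji'.symm)]
      · obtain ⟨x, hx, hx0⟩ := id hi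
        exact ⟨x, hx, fun h => absurd hi h, fun _ => hx0, fun j hj' hji => absurd ⟨j, hj', hji⟩ hj⟩
    · exact ⟨X i, (hXP i hi).1, fun _ => rfl, fun h => absurd h hi,
        fun j hj hji => absurd (hji ▸ hcycP j hj) hi⟩
  choose e he1 he2 he3 he4 using h2
  have hpair : ∀ j i, (if Cyc j then none else some (P j)) = some i → ¬ Cyc j ∧ P j = i := by
    intro j i h
    by_cases hj : Cyc j
    · simp [hj] at h
    · exact ⟨hj, by simpa [hj] using h⟩
  refine ⟨e, fun j => if Cyc j then none else some (P j), he1, fun j hj => ?_, fun j i h => ?_,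
    fun j j' i h h' => ?_, fun j i h => ?_, fun j i h => ?_, fun j i h => ?_⟩
  · by_cases hc : Cyc j
    · exact he3 j hc
    · simp [hc] at hj
  · obtain ⟨hj, hji⟩ := hpair j i h
    rw [he2 j hj, he4 i j hj hji]
  · obtain ⟨hj, hji⟩ := hpair j i h
    obtain ⟨hj', hji'⟩ := hpair j' i h'
    exact hinj j j' hj hj' (hji.trans hji'.symm)
  · obtain ⟨hj, rfl⟩ := hpair j i h
    simp [hcycP j hj]
  · obtain ⟨hj, rfl⟩ := hpair j i h
    exact (hlt j hj).1
  · obtain ⟨hj, rfl⟩ := hpair j i h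
    exact (hlt j hj).2

/-- The part of the space of chains that is spanned by the leading elements of a triangular family
is independent of the family. -/
theorem span_image_eq_supported [Finite ι] {e : ι → ι →₀ k} (he : ∀ i, LeadsAt r deg (e i) i)
    (hr : Function.Injective r) (A : Set ι)
    (hA : ∀ i ∈ A, ∀ j, r j ≤ r i → deg j = deg i → j ∈ A) :
    Submodule.span k (e '' A) = Finsupp.supported k k A := by
  classical
  apply le_antisymm
  · rw [Submodule.span_le]
    rintro _ ⟨i, hi, rfl⟩
    rw [SetLike.mem_coe, Finsupp.mem_supported]
    intro j hj
    have := (he i).2 j (Finsupp.mem_support_iff.1 hj)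
    exact hA i hi j this.1 this.2
  · suffices h : ∀ i ∈ A, Finsupp.single i (1 : k) ∈ Submodule.span k (e '' A) by
      rw [Finsupp.supported_eq_span_single, Submodule.span_le]
      rintro _ ⟨i, hi, rfl⟩
      exact h i hi
    intro i
    have : IsTrans ι fun i j => r i < r j := ⟨fun _ _ _ => lt_trans⟩
    have : Std.Irrefl fun i j => r i < r j := ⟨fun _ => lt_irrefl _⟩
    induction i using (Finite.wellFounded_of_trans_of_irrefl fun i j => r i < r j).induction with
    | _ i ih =>
    intro hi
    have hdec : e i = Finsupp.single i (e i i) + (e i).erase i := (Finsupp.single_add_erase i _).symm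
    have herase : (e i).erase i ∈ Submodule.span k (e '' A) := by
      rw [← Finsupp.sum_single ((e i).erase i)]
      refine Submodule.sum_mem _ fun j hj => ?_
      rw [← mul_one ((e i).erase i j), ← smul_eq_mul, ← Finsupp.smul_single]
      refine Submodule.smul_mem _ _ ?_
      rw [Finsupp.support_erase, Finset.mem_erase, Finsupp.mem_support_iff] at hj
      have := (he i).2 j hj.2
      exact ih j (lt_of_le_of_ne this.1 fun h => hj.1 (hr h)) (hA i hi j this.1 this.2)
    -- The triangular relation is solved for its leading term; the lower terms lie in the span by
    -- induction on the rank.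
    have : Finsupp.single i (1 : k) = (e i i)⁻¹ • (e i - (e i).erase i) := by
      conv_rhs => rw [hdec]
      simp [(he i).1]
    rw [this]
    exact Submodule.smul_mem _ _ (Submodule.sub_mem _ (Submodule.subset_span ⟨i, hi, rfl⟩) herase)

/-- A triangular family spans everything and has as many members as the dimension. -/
theorem linearIndependent_of_leadsAt [Finite ι] {e : ι → ι →₀ k}
    (he : ∀ i, LeadsAt r deg (e i) i) (hr : Function.Injective r) : LinearIndependent k e := by
  have := Fintype.ofFinite ι
  refine linearIndependent_of_top_le_span_of_card_eq_finrank ?_ (by simp)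
  rw [← Set.image_univ, span_image_eq_supported he hr _ (by simp), Finsupp.supported_univ]

end ReducedBasis

/-! ## The simplicial boundary -/

section Boundary

variable {k : Type*} [Field k] {V : Type*} [LinearOrder V]

theorem boundary_simplexChain (σ : Finset V) :
    boundary k (simplexChain k σ) = if 2 ≤ σ.card then
      ∑ v ∈ σ, (-1 : k) ^ (σ.filter (· < v)).card • simplexChain k (σ.erase v) else 0 := by
  unfold boundary simplexChain
  exact (Finsupp.linearCombination_single _ _ _).trans (one_smul _ _)

theorem card_filter_erase_add {σ : Finset V} {v w : V} (hv : v ∈ σ) (hvw : v < w) :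
    ((σ.erase v).filter (· < w)).card + 1 = (σ.filter (· < w)).card := by
  rw [Finset.filter_erase, Finset.card_erase_add_one]
  simp [hv, hvw]

theorem filter_erase_of_lt (σ : Finset V) {v w : V} (hvw : v < w) :
    (σ.erase w).filter (· < v) = σ.filter (· < v) := by
  rw [Finset.filter_erase, Finset.erase_eq_of_notMem]
  simp [hvw.le]

theorem boundary_boundary (x : ChainSpace k V) : boundary k (boundary k x) = 0 := by
  suffices h : (boundary k (V := V)).comp (boundary k) = 0 from LinearMap.congr_fun h x
  refine Finsupp.lhom_ext' fun σ => LinearMap.ext_ring ?_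
  change boundary k (boundary k (simplexChain k σ)) = 0
  rw [boundary_simplexChain]
  split_ifs with h2
  swap
  · exact map_zero _
  rw [map_sum]
  simp_rw [map_smul, boundary_simplexChain]
  -- For an edge, each term vanishes because the boundary of a vertex is `0` by convention; the
  -- cancellation in pairs is needed only from triangles on.
  by_cases h3 : 3 ≤ σ.card
  swap
  · refine Finset.sum_eq_zero fun v hv => ?_
    rw [if_neg, smul_zero]
    rw [Finset.card_erase_of_mem hv]
    omega
  have : ∀ v ∈ σ, 2 ≤ (σ.erase v).card := fun v hv => by
    rw [Finset.card_erase_of_mem hv]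
    omega
  rw [Finset.sum_congr rfl fun v hv => by rw [if_pos (this v hv), Finset.smul_sum],
    Finset.sum_sigma']
  have sgn : ∀ v w, v ∈ σ → v < w →
      (-1 : k) ^ (σ.filter (· < v)).card * (-1) ^ ((σ.erase v).filter (· < w)).card +
      (-1 : k) ^ (σ.filter (· < w)).card * (-1) ^ ((σ.erase w).filter (· < v)).card = 0 := by
    intro v w hv hvw
    rw [filter_erase_of_lt σ hvw, ← card_filter_erase_add hv hvw, pow_succ]
    ring
  -- Deleting two vertices in either order gives the same face with opposite signs.
  refine Finset.sum_involution (fun x _ => ⟨x.2, x.1⟩) ?_ ?_ ?_ ?_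
  · rintro ⟨v, w⟩ h
    simp only [Finset.mem_sigma, Finset.mem_erase] at h
    simp only [smul_smul]
    rw [Finset.erase_right_comm, ← add_smul]
    rcases lt_or_gt_of_ne h.2.1 with hlt | hlt
    · rw [add_comm, sgn w v h.2.2 hlt, zero_smul]
    · rw [sgn v w h.1 hlt, zero_smul]
  · rintro ⟨v, w⟩ h - heq
    simp only [Finset.mem_sigma, Finset.mem_erase] at h
    exact h.2.1 (congrArg Sigma.fst heq)
  · rintro ⟨v, w⟩ h
    simp only [Finset.mem_sigma, Finset.mem_erase] at h ⊢
    exact ⟨h.2.2, Ne.symm h.2.1, h.1⟩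
  · rintro ⟨v, w⟩ h
    rfl

theorem exists_of_boundary_ne_zero {σ τ : Finset V}
    (h : (show Finset V →₀ k from boundary k (simplexChain k σ)) τ ≠ 0) :
    2 ≤ σ.card ∧ ∃ v ∈ σ, τ = σ.erase v := by
  rw [boundary_simplexChain] at h
  split_ifs at h with h2
  · refine ⟨h2, ?_⟩
    by_contra! hc
    apply h
    change (∑ v ∈ σ, (-1 : k) ^ (σ.filter (· < v)).card •
      (Finsupp.single (σ.erase v) (1 : k) : Finset V →₀ k)) τ = 0
    rw [Finsupp.finsetSum_apply]
    refine Finset.sum_eq_zero fun v hv => ?_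
    rw [Finsupp.smul_apply, Finsupp.single_eq_of_ne (hc v hv), smul_zero]
  · exact absurd rfl h

end Boundary

/-! ## Uniqueness of barcodes -/

section Barcode

variable {k : Type*} [Field k]

theorem RealInterval.carrier_injective : Function.Injective RealInterval.carrier := by
  rintro ⟨s, _, _⟩ ⟨t, _, _⟩ h
  cases h
  rfl

theorem PersistenceModule.IsIso.finrank_range_map {V W : PersistenceModule k} (h : V.IsIso W)
    {s t : ℝ} (hst : s ≤ t) : Module.finrank k (LinearMap.range (V.map hst)) =
      Module.finrank k (LinearMap.range (W.map hst)) := by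
  obtain ⟨e, he⟩ := h
  have h1 : (e t).toLinearMap ∘ₗ V.map hst = W.map hst ∘ₗ (e s).toLinearMap :=
    LinearMap.ext fun x => he s t hst x
  rw [← LinearEquiv.finrank_map_eq (e t), ← LinearMap.range_comp, h1,
    LinearMap.range_comp_of_range_eq_top _ (LinearEquiv.range (e s))]

-- The image is the coordinate subspace of the intervals that contain both `s` and `t`; `g`
-- parametrizes it.
open Classical in
theorem finrank_range_map_directSum_intervalModule {n : ℕ} (J : Fin n → RealInterval) {s t : ℝ}
    (hst : s ≤ t) :
    Module.finrank k (LinearMap.range ((directSum fun i => intervalModule k (J i)).map hst)) =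
      Fintype.card {i // s ∈ (J i).carrier ∧ t ∈ (J i).carrier} := by
  let g : ({i // s ∈ (J i).carrier ∧ t ∈ (J i).carrier} → k) →ₗ[k]
      ∀ i, intervalSpace k (J i) t :=
    { toFun := fun a i => if h : s ∈ (J i).carrier ∧ t ∈ (J i).carrier then
        ⟨a ⟨i, h⟩, mem_intervalSpace.2 fun h' => absurd h.2 h'⟩ else 0
      map_add' := fun a b => by
        ext i
        by_cases h : s ∈ (J i).carrier ∧ t ∈ (J i).carrier <;> simp [h]
      map_smul' := fun c a => by
        ext i
        by_cases h : s ∈ (J i).carrier ∧ t ∈ (J i).carrier <;> simp [h] }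
  have hg : Function.Injective g := by
    intro a b hab
    ext ⟨i, hi⟩
    have := congrArg Subtype.val (congrFun hab i)
    simpa [g, hi] using this
  have hrange : LinearMap.range ((directSum fun i => intervalModule k (J i)).map hst) =
      LinearMap.range g := by
    apply le_antisymm
    · rintro _ ⟨x, rfl⟩
      refine ⟨fun i => (show intervalSpace k (J i.1) s from x i.1).1, ?_⟩
      funext i
      apply Subtype.ext
      change _ = if t ∈ (J i).carrier then (show intervalSpace k (J i) s from x i).1 else 0
      by_cases hs : s ∈ (J i).carrier
      · by_cases ht : t ∈ (J i).carrier
        · simp [g, hs, ht]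
        · simp [g, ht]
      · have := mem_intervalSpace.1 (show intervalSpace k (J i) s from x i).2 hs
        simp [g, hs, this]
    · rintro _ ⟨a, rfl⟩
      refine ⟨fun i => (⟨if h : s ∈ (J i).carrier ∧ t ∈ (J i).carrier then a ⟨i, h⟩ else 0,
        mem_intervalSpace.2 fun h' => by simp [h']⟩ : intervalSpace k (J i) s), ?_⟩
      funext i
      apply Subtype.ext
      change (if t ∈ (J i).carrier then
        (if h : s ∈ (J i).carrier ∧ t ∈ (J i).carrier then a ⟨i, h⟩ else 0) else 0) = _
      by_cases hs : s ∈ (J i).carrier <;> by_cases ht : t ∈ (J i).carrier <;> simp [g, hs, ht]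
  rw [hrange]
  exact (LinearMap.finrank_range_of_inj hg).trans (Module.finrank_fintype_fun_eq_card k)

open Classical in
theorem IsBarcode.finrank_range_map {V : PersistenceModule k} {B : Multiset RealInterval}
    (h : IsBarcode V B) {s t : ℝ} (hst : s ≤ t) :
    Module.finrank k (LinearMap.range (V.map hst)) =
      B.countP fun J => s ∈ J.carrier ∧ t ∈ J.carrier := by
  obtain ⟨n, J, rfl, hiso⟩ := h
  rw [hiso.finrank_range_map hst, finrank_range_map_directSum_intervalModule, Multiset.countP_map,
    Fintype.card_subtype]
  rfl

-- The ranks determine the barcode. Among the intervals whose multiplicities differ, take an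
-- inclusion-maximal `J`. Two points of `J` can be found that lie together in no other such
-- interval, so the counts at these points disagree.
open Classical in
theorem eq_of_countP_eq {B B' : Multiset RealInterval}
    (h : ∀ s t : ℝ, s ≤ t → (B.countP fun J => s ∈ J.carrier ∧ t ∈ J.carrier) =
      B'.countP fun J => s ∈ J.carrier ∧ t ∈ J.carrier) : B = B' := by
  set U := (B + B').toFinset with hU
  set T := U.filter fun J => B.count J ≠ B'.count J with hT
  have hmem : ∀ J, B.count J ≠ B'.count J → J ∈ T := by
    intro J hJ
    refine Finset.mem_filter.2 ⟨?_, hJ⟩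
    rw [hU, Multiset.mem_toFinset, Multiset.mem_add]
    by_contra! hc
    exact hJ (by rw [Multiset.count_eq_zero.2 hc.1, Multiset.count_eq_zero.2 hc.2])
  by_contra hne
  have hTne : T.Nonempty := by
    by_contra hemp
    refine hne (Multiset.ext.2 fun J => ?_)
    by_contra hJ
    exact hemp ⟨J, hmem J hJ⟩
  obtain ⟨J, hJT, hmax⟩ := Finset.exists_maximalFor RealInterval.carrier T hTne
  -- For each competing `a`, maximality of `J` gives a point of `J` outside `a`. The smallest and
  -- largest of these points serve as `s` and `t`: an interval containing both contains all points
  -- in between, hence is no competitor.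
  have hx : ∀ a, ∃ x ∈ J.carrier, a ∈ T → a ≠ J → x ∉ a.carrier := by
    intro a
    by_cases ha : a ∈ T ∧ a ≠ J
    · have hsub : ¬ J.carrier ⊆ a.carrier := fun hs =>
        ha.2 (RealInterval.carrier_injective ((hmax ha.1 hs).antisymm hs))
      obtain ⟨x, hx, hxa⟩ := Set.not_subset.1 hsub
      exact ⟨x, hx, fun _ _ => hxa⟩
    · obtain ⟨x, hx⟩ := J.nonempty
      exact ⟨x, hx, fun h1 h2 => absurd ⟨h1, h2⟩ ha⟩
  choose x hxJ hxa using hx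
  obtain ⟨a₁, -, hmin⟩ := Finset.exists_min_image T x hTne
  obtain ⟨a₂, -, hmax'⟩ := Finset.exists_max_image T x hTne
  have hst : x a₁ ≤ x a₂ := (hmin J hJT).trans (hmax' J hJT)
  have hsum : ∀ C : Multiset RealInterval, (∀ a ∈ C, a ∈ U) →
      (C.countP fun a => x a₁ ∈ a.carrier ∧ x a₂ ∈ a.carrier) =
        ∑ a ∈ U, if x a₁ ∈ a.carrier ∧ x a₂ ∈ a.carrier then C.count a else 0 := by
    intro C hC
    rw [Multiset.countP_eq_card_filter, ← Multiset.sum_count_eq_card (s := U)]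
    · simp_rw [Multiset.count_filter]
    · intro a ha
      exact hC a (Multiset.mem_of_mem_filter ha)
  have key := h _ _ hst
  rw [hsum B (by simp +contextual [hU]), hsum B' (by simp +contextual [hU]),
    ← Finset.add_sum_erase _ _ (Finset.filter_subset _ _ hJT),
    ← Finset.add_sum_erase _ _ (Finset.filter_subset _ _ hJT), if_pos ⟨hxJ _, hxJ _⟩,
    if_pos ⟨hxJ _, hxJ _⟩] at key
  rw [Finset.sum_congr rfl (g := fun a => if x a₁ ∈ a.carrier ∧ x a₂ ∈ a.carrier then
    B'.count a else 0)] at key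
  · exact (Finset.mem_filter.1 hJT).2 (Nat.add_right_cancel key)
  · intro a ha
    have haJ := Finset.ne_of_mem_erase ha
    by_cases haT : a ∈ T
    · rw [if_neg, if_neg] <;>
      exact fun hc => hxa a haT haJ (a.ordConnected.out hc.1 hc.2 ⟨hmin a haT, hmax' a haT⟩)
    · have : B.count a = B'.count a := by
        by_contra hc
        exact haT (hmem a hc)
      rw [this]

theorem IsBarcode.eq {V : PersistenceModule k} {B B' : Multiset RealInterval}
    (h : IsBarcode V B) (h' : IsBarcode V B') : B = B' := by
  classical
  exact eq_of_countP_eq fun s t hst => by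
    rw [← h.finrank_range_map hst, ← h'.finrank_range_map hst]

/-- Uniqueness makes the chosen barcode computable from any explicit decomposition. -/
theorem IsBarcode.barcode_eq {V : PersistenceModule k} {B : Multiset RealInterval}
    (h : IsBarcode V B) : barcode V = B := by
  unfold barcode
  rw [dif_pos ⟨B, h⟩]
  exact (Exists.choose_spec (⟨B, h⟩ : ∃ B, IsBarcode V B)).eq h

/-- An interval decomposition indexed by an arbitrary finite type. -/
theorem isBarcode_of_linearEquiv {V : PersistenceModule k} {β : Type*} [Fintype β]
    (J : β → RealInterval) (e : ∀ t, V.space t ≃ₗ[k] ∀ i, (intervalModule k (J i)).space t)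
    (he : ∀ (s t : ℝ) (h : s ≤ t) (x : V.space s) (i : β),
      e t (V.map h x) i = (intervalModule k (J i)).map h (e s x i)) :
    IsBarcode V (Finset.univ.val.map J) := by
  let ε := (Fintype.equivFin β).symm
  refine ⟨Fintype.card β, J ∘ ε, ?_, fun t => (e t).trans
    (LinearEquiv.piCongrLeft' k (fun i => (intervalModule k (J i)).space t) ε.symm), ?_⟩
  · rw [← Multiset.map_map]
    congr 1
    simp
  · intro s t h x
    funext i
    exact he s t h x (ε i)

end Barcode

/-! ## The bottleneck distance of diagrams with a common index set -/

section Bottleneck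

theorem extDist_self (x : WithTop ℝ) : extDist x x = 0 := by
  cases x with
  | top => rfl
  | coe a => exact edist_self a

theorem extDist_comm (x y : WithTop ℝ) : extDist x y = extDist y x := by
  cases x with
  | top => cases y with
    | top => rfl
    | coe b => rfl
  | coe a => cases y with
    | top => rfl
    | coe b => exact edist_comm a b

theorem planeDist_self (x : ℝ × WithTop ℝ) : planeDist x x = 0 := by
  simp [planeDist, extDist_self]

theorem planeDist_comm (x y : ℝ × WithTop ℝ) : planeDist x y = planeDist y x := by
  simp [planeDist, extDist_comm, edist_comm]

theorem bottleneckDist_comm (D D' : Diagram) : bottleneckDist D D' = bottleneckDist D' D := by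
  have : ∀ D D' : Diagram, bottleneckDist D D' ≤ bottleneckDist D' D := by
    intro D D'
    refine le_iInf fun γ => (iInf_le _ γ.symm).trans (iSup_le fun x => ?_)
    rw [planeDist_comm]
    refine le_trans (le_of_eq ?_) (le_iSup (fun y => planeDist y.loc (γ y).loc) (γ.symm x))
    rw [γ.apply_symm_apply]
  exact le_antisymm (this _ _) (this _ _)

/-- A countable family of diagonal points can be absorbed by the diagonal. -/
theorem exists_equiv_absorb {α : Type*} [Countable α] (b : α → ℝ) :
    ∃ ε : α ⊕ (ℝ × ℕ) ≃ ℝ × ℕ, (∀ i, (ε (Sum.inl i)).1 = b i) ∧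
      ∀ y, (ε (Sum.inr y)).1 = y.1 := by
  let F : α ⊕ (ℝ × ℕ) → ℝ := Sum.elim b Prod.fst
  -- Over each location `t` the fibre is infinite, by the copies of the diagonal point, and
  -- countable; so it can be renumbered by `ℕ`.
  have h : ∀ t, Nonempty ({x // F x = t} ≃ ℕ) := by
    intro t
    have hc : Countable {x // F x = t} := by
      have hinj : Function.Injective (fun x : {x // F x = t} =>
          (Sum.map id Prod.snd x.1 : α ⊕ ℕ)) := by
        rintro ⟨x | ⟨x, n⟩, hx⟩ ⟨y | ⟨y, m⟩, hy⟩ hxy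
        · obtain rfl : x = y := by simpa using hxy
          rfl
        · simp at hxy
        · simp at hxy
        · obtain rfl : x = t := hx
          obtain rfl : y = x := hy
          obtain rfl : n = m := by simpa using hxy
          rfl
      exact hinj.countable
    have hi : Infinite {x // F x = t} :=
      Infinite.of_injective (fun n : ℕ => ⟨Sum.inr (t, n), rfl⟩) fun n m hnm => by
        simpa using congrArg Subtype.val hnm
    exact nonempty_equiv_of_countable
  let φ := fun t => (h t).some
  let ε : α ⊕ (ℝ × ℕ) ≃ ℝ × ℕ := (Equiv.sigmaFiberEquiv F).symm.trans
    ((Equiv.sigmaCongrRight φ).trans (Equiv.sigmaEquivProd ℝ ℕ))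
  exact ⟨ε, fun i => rfl, fun y => rfl⟩

/-- The finite diagram of the points `a i`, `i ∈ N`, that lie off the diagonal. -/
noncomputable def indexedDiagram {ι : Type*} (N : Finset ι) (a : ι → ℝ × WithTop ℝ) : Diagram :=
  open Classical in (N.filter fun i => (a i).2 ≠ (a i).1).val.map a

/-- The points of the finite part of `indexedDiagram` are the off-diagonal indices. -/
theorem exists_equiv_toType {ι : Type*} (N : Finset ι) (a : ι → ℝ × WithTop ℝ) :
    ∃ ε : {i : N // (a i).2 ≠ (a i).1} ≃ (indexedDiagram N a).ToType,
      ∀ i, (ε i).1 = a i.1 := by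
  classical
  set s := N.filter fun i => (a i).2 ≠ (a i).1 with hs
  have hbij : Function.Bijective
      (fun x : s.val.ToType => (⟨⟨x.1, (Finset.mem_filter.1 (Multiset.coe_mem (x := x))).1⟩,
        (Finset.mem_filter.1 (Multiset.coe_mem (x := x))).2⟩ :
          {i : N // (a i).2 ≠ (a i).1})) := by
    constructor
    · rintro ⟨x, i⟩ ⟨y, j⟩ h
      obtain rfl : x = y := by simpa using h
      have h1 := Multiset.nodup_iff_count_le_one.1 s.nodup x
      congr 1
      apply Fin.ext
      have := i.2
      have := j.2
      omega
    · rintro ⟨⟨x, hx⟩, hxa⟩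
      have : x ∈ s.val := Finset.mem_filter.2 ⟨hx, hxa⟩
      exact ⟨⟨x, ⟨0, Multiset.count_pos.2 this⟩⟩, rfl⟩
  refine ⟨(Equiv.ofBijective _ hbij).symm.trans (s.val.mapEquiv a), fun i => ?_⟩
  refine (Multiset.mapEquiv_apply _ _ _).trans ?_
  have := (Equiv.ofBijective _ hbij).apply_symm_apply i
  exact congrArg (fun j => a j.1.1) this

/-- The indices whose point lies on the diagonal are absorbed into the diagonal copies. All of `N`
thus indexes the diagram whichever bars degenerate, so diagrams of different functions can be
compared index by index. -/
theorem exists_equiv_point {ι : Type*} (N : Finset ι) (a : ι → ℝ × WithTop ℝ) :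
    ∃ ε : N ⊕ (ℝ × ℕ) ≃ (indexedDiagram N a).Point, (∀ i, (ε (Sum.inl i)).loc = a i) ∧
      ∀ y, (ε (Sum.inr y)).loc = (y.1, ((y.1 : ℝ) : WithTop ℝ)) := by
  classical
  obtain ⟨ε₁, h₁⟩ := exists_equiv_toType N a
  obtain ⟨ε₂, h₂, h₂'⟩ := exists_equiv_absorb
    fun i : {i : N // ¬ (a i).2 ≠ (a i).1} => (a i.1).1
  let ε : N ⊕ (ℝ × ℕ) ≃ (indexedDiagram N a).Point :=
    (Equiv.sumCongr (Equiv.sumCompl fun i : N => (a i).2 ≠ (a i).1).symm (Equiv.refl _)).trans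
      ((Equiv.sumAssoc _ _ _).trans (Equiv.sumCongr ε₁ ε₂))
  refine ⟨ε, fun i => ?_, fun y => ?_⟩
  · by_cases hi : (a i).2 ≠ (a i).1
    · have : ε (Sum.inl i) = Sum.inl (ε₁ ⟨i, hi⟩) := by
        change Sum.map ε₁ ε₂ (Equiv.sumAssoc _ _ _ (Sum.inl ((Equiv.sumCompl _).symm i))) = _
        rw [Equiv.sumCompl_symm_apply_of_pos (p := fun i : N => (a i).2 ≠ (a i).1) hi]
        rfl
      rw [this]
      exact h₁ _
    · have : ε (Sum.inl i) = Sum.inr (ε₂ (Sum.inl ⟨i, hi⟩)) := by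
        change Sum.map ε₁ ε₂ (Equiv.sumAssoc _ _ _ (Sum.inl ((Equiv.sumCompl _).symm i))) = _
        rw [Equiv.sumCompl_symm_apply_of_neg (p := fun i : N => (a i).2 ≠ (a i).1) hi]
        rfl
      rw [this]
      change ((ε₂ _).1, (((ε₂ _).1 : ℝ) : WithTop ℝ)) = _
      rw [h₂]
      exact Prod.ext rfl (not_not.1 hi).symm
  · change ((ε₂ _).1, (((ε₂ _).1 : ℝ) : WithTop ℝ)) = _
    rw [h₂']
    rfl

theorem bottleneckDist_indexedDiagram_le {ι : Type*} (N : Finset ι) (a b : ι → ℝ × WithTop ℝ)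
    {C : ℝ≥0∞} (h : ∀ i ∈ N, planeDist (a i) (b i) ≤ C) :
    bottleneckDist (indexedDiagram N a) (indexedDiagram N b) ≤ C := by
  obtain ⟨ε, h₁, h₂⟩ := exists_equiv_point N a
  obtain ⟨ε', h₁', h₂'⟩ := exists_equiv_point N b
  refine (iInf_le _ (ε.symm.trans ε')).trans (iSup_le fun x => ?_)
  obtain ⟨y, rfl⟩ := ε.surjective x
  rw [Equiv.trans_apply, Equiv.symm_apply_apply]
  rcases y with i | y
  · rw [h₁, h₁']
    exact h i i.2
  · rw [h₂, h₂', planeDist_self]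
    exact zero_le

/-- If all points of the first diagram are further than `m` from the diagonal, then a matching of
cost less than `m` matches them with points of the second diagram. -/
theorem exists_injOn_of_bottleneckDist_lt {ι : Type*} (N : Finset ι)
    (a b : ι → ℝ × WithTop ℝ) {m : ℝ≥0∞}
    (hm : ∀ i ∈ N, ∀ t : ℝ, m ≤ planeDist (a i) (t, (t : WithTop ℝ)))
    (h : bottleneckDist (indexedDiagram N a) (indexedDiagram N b) < m) :
    ∃ π : ι → ι, Set.InjOn π N ∧ ∀ i ∈ N, π i ∈ N ∧ planeDist (a i) (b (π i)) < m := by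
  classical
  obtain ⟨γ, hγ⟩ := iInf_lt_iff.1 h
  have hγ' : ∀ x, planeDist x.loc (γ x).loc < m := fun x => (le_iSup _ x).trans_lt hγ
  obtain ⟨ε, h₁, -⟩ := exists_equiv_point N a
  obtain ⟨ε', h₁'⟩ := exists_equiv_toType N b
  have key : ∀ i : N, ∃ j : {j : N // (b j).2 ≠ (b j).1},
      γ (ε (Sum.inl i)) = Sum.inl (ε' j) := by
    intro i
    have := hγ' (ε (Sum.inl i))
    rw [h₁] at this
    rcases hz : γ (ε (Sum.inl i)) with z | ⟨t, n⟩
    · obtain ⟨j, rfl⟩ := ε'.surjective z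
      exact ⟨j, rfl⟩
    · rw [hz] at this
      exact absurd (hm i i.2 t) (not_le.2 this)
  choose π hπ using key
  refine ⟨fun i => if hi : i ∈ N then (π ⟨i, hi⟩).1.1 else i, fun i hi j hj hij => ?_,
    fun i hi => ?_⟩
  · rw [Finset.mem_coe] at hi hj
    dsimp only at hij
    rw [dif_pos hi, dif_pos hj] at hij
    have h3 : π ⟨i, hi⟩ = π ⟨j, hj⟩ := Subtype.ext (Subtype.ext hij)
    have h4 := (hπ ⟨i, hi⟩).trans ((congrArg (fun z => Sum.inl (ε' z)) h3).trans (hπ ⟨j, hj⟩).symm)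
    exact congrArg Subtype.val (Sum.inl_injective (ε.injective (γ.injective h4)))
  · dsimp only
    rw [dif_pos hi]
    have := hγ' (ε (Sum.inl ⟨i, hi⟩))
    rw [h₁, hπ] at this
    change planeDist _ (ε' (π ⟨i, hi⟩)).1 < m at this
    rw [h₁'] at this
    exact ⟨(π ⟨i, hi⟩).1.2, this⟩

end Bottleneck

/-! ## The persistence diagram in terms of a pairing of the simplices -/

section Pairing

variable {k : Type*} [Field k] {V : Type*} [LinearOrder V] {K : PreAbstractSimplicialComplex V}

/-- A basis of the chains of `K` adapted to all subcomplexes that are initial segments for the rank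
`r`, such that the boundary of each element is zero or again an element of the basis. -/
structure IsAdaptedBasis (r : K.faces → ℝ) (E : K.faces → ChainSpace k V)
    (pair : K.faces → Option K.faces) : Prop where
  linearIndependent : LinearIndependent k E
  chains_eq : ∀ (p : ℕ) (L : PreAbstractSimplicialComplex V), L ≤ K →
    (∀ i j : K.faces, i.1 ∈ L.faces → r j ≤ r i → j.1 ∈ L.faces) →
    chains k p L = Submodule.span k (E '' {i | i.1 ∈ L.faces ∧ i.1.card = p + 1})
  boundary_eq_zero : ∀ j, pair j = none → boundary k (E j) = 0
  boundary_eq : ∀ j i, pair j = some i → boundary k (E j) = E i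
  inj : ∀ j j' i, pair j = some i → pair j' = some i → j = j'
  pair_eq_none : ∀ j i, pair j = some i → pair i = none
  rank_lt : ∀ j i, pair j = some i → r i < r j
  card_eq : ∀ j i, pair j = some i → i.1.card + 1 = j.1.card

/-- The reduction is carried out on combinations of simplices of `K` and transported by `φ`. The map
`φ` intertwines the differentials because the boundary of a simplex of `K` is supported in `K`;
injectivity of `r` makes proper faces strictly earlier. -/
theorem exists_isAdaptedBasis (k : Type*) [Field k] [Finite K.faces] {r : K.faces → ℝ}
    (hr : Function.Injective r) (hf : IsFilterFunction r) :
    ∃ (E : K.faces → ChainSpace k V) (pair : K.faces → Option K.faces),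
      IsAdaptedBasis r E pair := by
  let φ : (K.faces →₀ k) →ₗ[k] ChainSpace k V :=
    (Finsupp.lmapDomain k k Subtype.val : (K.faces →₀ k) →ₗ[k] (Finset V →₀ k))
  let ψ : ChainSpace k V →ₗ[k] (K.faces →₀ k) :=
    (Finsupp.lcomapDomain Subtype.val Subtype.val_injective :
      (Finset V →₀ k) →ₗ[k] (K.faces →₀ k))
  let d : (K.faces →₀ k) →ₗ[k] (K.faces →₀ k) := ψ ∘ₗ boundary k ∘ₗ φ
  have hφinj : Function.Injective φ := Finsupp.mapDomain_injective Subtype.val_injective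
  have hφs : ∀ i : K.faces, φ (Finsupp.single i 1) = simplexChain k i.1 := fun i =>
    Finsupp.mapDomain_single
  have hbd : ∀ (i : K.faces) (τ : Finset V),
      (show Finset V →₀ k from boundary k (simplexChain k i.1)) τ ≠ 0 →
      ∃ h : τ ∈ K.faces, r ⟨τ, h⟩ < r i ∧ τ.card + 1 = i.1.card := by
    intro i τ h
    obtain ⟨h2, v, hv, rfl⟩ := exists_of_boundary_ne_zero h
    have hc := Finset.card_erase_add_one hv
    have hK : i.1.erase v ∈ K.faces :=
      (K.isRelLowerSet_faces i.2).2 (Finset.erase_subset _ _)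
        (Finset.card_pos.1 (by omega))
    refine ⟨hK, lt_of_le_of_ne (hf _ _ (Finset.erase_subset _ _)) fun heq => ?_, hc⟩
    have := congrArg Subtype.val (hr heq)
    exact Finset.erase_eq_self.1 this hv
  have hφd : ∀ x, φ (d x) = boundary k (φ x) := by
    suffices h : φ ∘ₗ d = boundary k ∘ₗ φ from fun x => LinearMap.congr_fun h x
    refine Finsupp.lhom_ext' fun i => LinearMap.ext_ring ?_
    change φ (ψ (boundary k (φ (Finsupp.single i 1)))) = boundary k (φ (Finsupp.single i 1))
    rw [hφs]
    refine Finsupp.mapDomain_comapDomain _ Subtype.val_injective _ fun τ hτ => ?_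
    obtain ⟨h, -⟩ := hbd i τ (Finsupp.mem_support_iff.1 hτ)
    exact ⟨⟨τ, h⟩, rfl⟩
  have hd : IsFilteredDifferential r (fun i => i.1.card) d := by
    refine ⟨fun x => hφinj ?_, fun i j h => ?_⟩
    · rw [hφd, hφd, boundary_boundary, map_zero]
    · change (show Finset V →₀ k from boundary k (φ (Finsupp.single i 1))) j.1 ≠ 0 at h
      rw [hφs] at h
      obtain ⟨_, h1, h2⟩ := hbd i j.1 h
      exact ⟨h1, h2⟩
  obtain ⟨e, pair, he⟩ := exists_isReducedBasis hr hd
  refine ⟨fun i => φ (e i), pair, ?_, ?_, ?_, ?_, he.inj, he.pair_eq_none, he.rank_lt, he.deg_eq⟩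
  · exact (linearIndependent_of_leadsAt he.leadsAt hr).map' φ (LinearMap.ker_eq_bot.2 hφinj)
  · intro p L hL hlow
    have h1 := span_image_eq_supported he.leadsAt hr {i | i.1 ∈ L.faces ∧ i.1.card = p + 1}
      fun i hi j hj hij => ⟨hlow i j hi.1 hj, hij.trans hi.2⟩
    have h2 := congrArg (Submodule.map φ) h1
    rw [Finsupp.supported_eq_span_single, Submodule.map_span, Submodule.map_span, ← Set.image_comp,
      ← Set.image_comp] at h2
    refine Eq.trans ?_ h2.symm
    unfold chains
    congr 1
    ext x
    constructor
    · rintro ⟨σ, ⟨h, hc⟩, rfl⟩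
      exact ⟨⟨σ, hL h⟩, ⟨h, hc⟩, hφs _⟩
    · rintro ⟨i, ⟨h, hc⟩, rfl⟩
      exact ⟨i.1, ⟨h, hc⟩, (hφs _).symm⟩
  · intro j hj
    rw [← hφd, he.map_eq_zero j hj, map_zero]
  · intro j i hj
    rw [← hφd, he.map_eq j i hj]

/-- The set of `t` for which the `i`-th element of an adapted basis is a cycle but not a boundary
of the sublevel complex at `t`. -/
def barSet (pair : K.faces → Option K.faces) (f : K.faces → ℝ) (i : K.faces) : Set ℝ :=
  {t | f i ≤ t ∧ ∀ j, pair j = some i → t < f j}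

open Classical in
/-- The point of the persistence diagram of `f` that is born with the simplex `i`. -/
noncomputable def barPoint (pair : K.faces → Option K.faces) (f : K.faces → ℝ) (i : K.faces) :
    ℝ × WithTop ℝ :=
  (f i, if h : ∃ j, pair j = some i then ((f h.choose : ℝ) : WithTop ℝ) else ⊤)

/-- The index set of the `p`-dimensional bars. -/
abbrev BarIndex (pair : K.faces → Option K.faces) (f : K.faces → ℝ) (p : ℕ) : Type _ :=
  {i : K.faces // (i.1.card = p + 1 ∧ pair i = none) ∧ ∀ j, pair j = some i → f i < f j}

/-- The interval of a bar. -/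
def bar {pair : K.faces → Option K.faces} {f : K.faces → ℝ} {p : ℕ} (i : BarIndex pair f p) :
    RealInterval where
  carrier := barSet pair f i.1
  nonempty := ⟨f i.1, le_rfl, i.2.2⟩
  ordConnected := ⟨fun _ hs _ ht _ hu => ⟨hs.1.trans hu.1, fun j hj => hu.2.trans_lt (ht.2 j hj)⟩⟩

variable {r : K.faces → ℝ} {E : K.faces → ChainSpace k V} {pair : K.faces → Option K.faces}

namespace IsAdaptedBasis

theorem barPoint_of_pair (h : IsAdaptedBasis r E pair) (f : K.faces → ℝ) {i j : K.faces}
    (hj : pair j = some i) : barPoint pair f i = (f i, ((f j : ℝ) : WithTop ℝ)) := by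
  have hex : ∃ j, pair j = some i := ⟨j, hj⟩
  unfold barPoint
  rw [dif_pos hex, h.inj _ _ _ hex.choose_spec hj]

theorem endpoints_bar (h : IsAdaptedBasis r E pair) {f : K.faces → ℝ} {p : ℕ}
    (i : BarIndex pair f p) : endpoints (bar i) = barPoint pair f i.1 := by
  by_cases hex : ∃ j, pair j = some i.1
  · obtain ⟨j, hj⟩ := hex
    have hlt := i.2.2 j hj
    have : (bar i).carrier = Set.Ico (f i.1) (f j) := by
      ext t
      refine ⟨fun ht => ⟨ht.1, ht.2 j hj⟩, fun ht => ⟨ht.1, fun j' hj' => ?_⟩⟩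
      rw [h.inj _ _ _ hj' hj]
      exact ht.2
    rw [h.barPoint_of_pair f hj, endpoints, this, csInf_Ico hlt, if_pos bddAbove_Ico,
      csSup_Ico hlt]
  · have : (bar i).carrier = Set.Ici (f i.1) := by
      ext t
      exact ⟨fun ht => ht.1, fun ht => ⟨ht, fun j hj => absurd ⟨j, hj⟩ hex⟩⟩
    rw [barPoint, dif_neg hex, endpoints, this, csInf_Ici, if_neg (not_bddAbove_Ici _)]

/-- Bars that are empty for `f` are exactly those whose point falls on the diagonal. -/
theorem barPoint_snd_ne_iff (h : IsAdaptedBasis r E pair) {f : K.faces → ℝ}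
    (hf : ∀ i j, r i ≤ r j → f i ≤ f j) (i : K.faces) :
    (barPoint pair f i).2 ≠ (barPoint pair f i).1 ↔ ∀ j, pair j = some i → f i < f j := by
  by_cases hex : ∃ j, pair j = some i
  · obtain ⟨j, hj⟩ := hex
    rw [h.barPoint_of_pair f hj]
    constructor
    · intro hne j' hj'
      rw [h.inj _ _ _ hj' hj]
      exact lt_of_le_of_ne (hf _ _ (h.rank_lt j i hj).le) fun heq => hne (by rw [heq])
    · intro hlt heq
      exact (hlt j hj).ne' (WithTop.coe_injective heq)
  · refine ⟨fun _ j hj => absurd ⟨j, hj⟩ hex, fun _ => ?_⟩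
    rw [barPoint, dif_neg hex]
    exact WithTop.top_ne_coe

variable {f : FilterFunction K}

/-- Weak monotonicity suffices: even when `f` has ties, its sublevel sets are initial segments for
`r`. Hence one basis serves the whole closure of the stratum. -/
theorem chains_sublevel (h : IsAdaptedBasis r E pair) (hf : ∀ i j, r i ≤ r j → f.1 i ≤ f.1 j)
    (p : ℕ) (t : ℝ) : chains k p (sublevel f t) =
      Submodule.span k (E '' {i | f.1 i ≤ t ∧ i.1.card = p + 1}) := by
  rw [h.chains_eq p (sublevel f t) (fun _ hσ => hσ.1)
    fun i j ⟨_, hi⟩ hj => ⟨j.2, (hf _ _ hj).trans hi⟩]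
  congr 2
  ext i
  exact and_congr_left fun _ => ⟨fun ⟨_, hi⟩ => hi, fun hi => ⟨i.2, hi⟩⟩

theorem mem_chains_sublevel (h : IsAdaptedBasis r E pair)
    (hf : ∀ i j, r i ≤ r j → f.1 i ≤ f.1 j) {t : ℝ} {i : K.faces} (hi : f.1 i ≤ t) {p : ℕ}
    (hp : i.1.card = p + 1) : E i ∈ chains k p (sublevel f t) := by
  rw [h.chains_sublevel hf]
  exact Submodule.subset_span ⟨i, ⟨hi, hp⟩, rfl⟩

/-- Coordinates with respect to the adapted basis. -/
theorem exists_coord (h : IsAdaptedBasis r E pair) : ∃ c : ChainSpace k V →ₗ[k] (K.faces →₀ k),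
    ∀ y, c (Finsupp.linearCombination k E y) = y := by
  obtain ⟨c, hc⟩ := LinearMap.exists_leftInverse_of_injective (Finsupp.linearCombination k E)
    (LinearMap.ker_eq_bot.2 h.linearIndependent)
  exact ⟨c, fun y => LinearMap.congr_fun hc y⟩

variable {c : ChainSpace k V →ₗ[k] (K.faces →₀ k)}

theorem coord_apply_basis {ι M : Type*} [AddCommGroup M] [Module k M] {E : ι → M}
    {c : M →ₗ[k] (ι →₀ k)} (hc : ∀ y, c (Finsupp.linearCombination k E y) = y) (i : ι) :
    c (E i) = Finsupp.single i 1 := by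
  rw [← hc (Finsupp.single i 1), Finsupp.linearCombination_single, one_smul]

theorem eq_of_mem_chains (h : IsAdaptedBasis r E pair) (hf : ∀ i j, r i ≤ r j → f.1 i ≤ f.1 j)
    (hc : ∀ y, c (Finsupp.linearCombination k E y) = y) {p : ℕ} {t : ℝ} {x : ChainSpace k V}
    (hx : x ∈ chains k p (sublevel f t)) : Finsupp.linearCombination k E (c x) = x ∧
      ∀ i, c x i ≠ 0 → f.1 i ≤ t ∧ i.1.card = p + 1 := by
  rw [h.chains_sublevel hf, Finsupp.mem_span_image_iff_linearCombination] at hx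
  obtain ⟨y, hy, rfl⟩ := hx
  rw [hc]
  exact ⟨rfl, fun i hi => hy (Finsupp.mem_support_iff.2 hi)⟩

/-- Only `E j` has boundary `E i`, and every other basis element has boundary zero or a different
basis element. -/
theorem coord_boundary_of_pair (h : IsAdaptedBasis r E pair)
    (hc : ∀ y, c (Finsupp.linearCombination k E y) = y) (y : K.faces →₀ k) {i j : K.faces}
    (hj : pair j = some i) : c (boundary k (Finsupp.linearCombination k E y)) i = y j := by
  suffices hs : Finsupp.lapply i ∘ₗ c ∘ₗ boundary k ∘ₗ Finsupp.linearCombination k E =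
      Finsupp.lapply j from LinearMap.congr_fun hs y
  refine Finsupp.lhom_ext' fun l => LinearMap.ext_ring ?_
  change c (boundary k (Finsupp.linearCombination k E (Finsupp.single l 1))) i =
    Finsupp.single l (1 : k) j
  rw [Finsupp.linearCombination_single, one_smul]
  rcases hl : pair l with _ | i'
  · rw [h.boundary_eq_zero l hl, map_zero, Finsupp.single_eq_of_ne, Finsupp.zero_apply]
    rintro rfl
    simp [hj] at hl
  · rw [h.boundary_eq l i' hl, coord_apply_basis hc]
    by_cases hjl : j = l
    · subst hjl
      obtain rfl : i = i' := Option.some_injective _ (hj.symm.trans hl)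
      rw [Finsupp.single_eq_same, Finsupp.single_eq_same]
    · rw [Finsupp.single_eq_of_ne hjl, Finsupp.single_eq_of_ne]
      rintro rfl
      exact hjl (h.inj _ _ _ hj hl)

theorem coord_boundary_of_not_pair (h : IsAdaptedBasis r E pair)
    (hc : ∀ y, c (Finsupp.linearCombination k E y) = y) (y : K.faces →₀ k) {i : K.faces}
    (hi : ∀ j, pair j ≠ some i) : c (boundary k (Finsupp.linearCombination k E y)) i = 0 := by
  suffices hs : Finsupp.lapply i ∘ₗ c ∘ₗ boundary k ∘ₗ Finsupp.linearCombination k E = 0 from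
    LinearMap.congr_fun hs y
  refine Finsupp.lhom_ext' fun l => LinearMap.ext_ring ?_
  change c (boundary k (Finsupp.linearCombination k E (Finsupp.single l 1))) i = 0
  rw [Finsupp.linearCombination_single, one_smul]
  rcases hl : pair l with _ | i'
  · rw [h.boundary_eq_zero l hl, map_zero, Finsupp.zero_apply]
  · rw [h.boundary_eq l i' hl, coord_apply_basis hc, Finsupp.single_eq_of_ne]
    rintro rfl
    exact hi l hl

theorem pair_eq_none_of_mem_cycles (h : IsAdaptedBasis r E pair)
    (hf : ∀ i j, r i ≤ r j → f.1 i ≤ f.1 j)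
    (hc : ∀ y, c (Finsupp.linearCombination k E y) = y) {p : ℕ} {t : ℝ} {x : ChainSpace k V}
    (hx : x ∈ cycles k p (sublevel f t)) {j : K.faces} (hj : c x j ≠ 0) : pair j = none := by
  rcases hp : pair j with _ | i
  · rfl
  · have h1 := h.coord_boundary_of_pair hc (c x) hp
    rw [(h.eq_of_mem_chains hf hc hx.1).1, LinearMap.mem_ker.1 hx.2, map_zero] at h1
    exact absurd h1.symm hj

theorem coord_eq_zero_of_mem_boundaries (h : IsAdaptedBasis r E pair)
    (hf : ∀ i j, r i ≤ r j → f.1 i ≤ f.1 j)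
    (hc : ∀ y, c (Finsupp.linearCombination k E y) = y) {p : ℕ} {t : ℝ} {x : ChainSpace k V}
    (hx : x ∈ boundaries k p (sublevel f t)) {i : K.faces} (hi : t ∈ barSet pair f.1 i) :
    c x i = 0 := by
  obtain ⟨y, hy, rfl⟩ := hx
  obtain ⟨h1, h2⟩ := h.eq_of_mem_chains hf hc hy
  rw [← h1]
  by_cases hex : ∃ j, pair j = some i
  · obtain ⟨j, hj⟩ := hex
    rw [h.coord_boundary_of_pair hc _ hj]
    by_contra hne
    exact absurd (h2 j hne).1 (not_le.2 (hi.2 j hj))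
  · exact h.coord_boundary_of_not_pair hc _ fun j hj => hex ⟨j, hj⟩

/-- Each basis element occurring in `x` has been born by time `t` but its bar is not alive, so its
partner has entered and bounds it. -/
theorem mem_boundaries_of_coord_eq_zero (h : IsAdaptedBasis r E pair)
    (hf : ∀ i j, r i ≤ r j → f.1 i ≤ f.1 j)
    (hc : ∀ y, c (Finsupp.linearCombination k E y) = y) {p : ℕ} {t : ℝ} {x : ChainSpace k V}
    (hx : x ∈ cycles k p (sublevel f t)) (h0 : ∀ i, t ∈ barSet pair f.1 i → c x i = 0) :
    x ∈ boundaries k p (sublevel f t) := by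
  obtain ⟨h1, h2⟩ := h.eq_of_mem_chains hf hc hx.1
  rw [← h1, Finsupp.linearCombination_apply]
  refine Submodule.sum_mem _ fun i hi => Submodule.smul_mem _ _ ?_
  rw [Finsupp.mem_support_iff] at hi
  obtain ⟨hit, hip⟩ := h2 i hi
  have hb : t ∉ barSet pair f.1 i := fun hb => hi (h0 i hb)
  obtain ⟨j, hj, hjt⟩ : ∃ j, pair j = some i ∧ f.1 j ≤ t := by
    by_contra! hcon
    exact hb ⟨hit, hcon⟩
  refine ⟨E j, h.mem_chains_sublevel hf hjt ?_, h.boundary_eq j i hj⟩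
  rw [← h.card_eq j i hj, hip]

open Classical in
/-- The coordinates of a cycle of a sublevel complex along the bars that are alive. -/
noncomputable def barCoord (c : ChainSpace k V →ₗ[k] (K.faces →₀ k))
    (pair : K.faces → Option K.faces) (f : FilterFunction K) (p : ℕ) (t : ℝ) :
    cycles k p (sublevel f t) →ₗ[k] ∀ i : BarIndex pair f.1 p, intervalSpace k (bar i) t where
  toFun z i := ⟨if t ∈ (bar i).carrier then c z i.1 else 0, mem_intervalSpace.2 fun h => if_neg h⟩
  map_add' x y := by
    ext i
    by_cases h : t ∈ (bar i).carrier <;> simp [h]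
  map_smul' a x := by
    ext i
    by_cases h : t ∈ (bar i).carrier <;> simp [h]

theorem ker_barCoord (h : IsAdaptedBasis r E pair) (hf : ∀ i j, r i ≤ r j → f.1 i ≤ f.1 j)
    (hc : ∀ y, c (Finsupp.linearCombination k E y) = y) (p : ℕ) (t : ℝ) :
    LinearMap.ker (barCoord c pair f p t) =
      (boundaries k p (sublevel f t)).submoduleOf (cycles k p (sublevel f t)) := by
  ext ⟨z, hz⟩
  rw [LinearMap.mem_ker]
  change barCoord c pair f p t ⟨z, hz⟩ = 0 ↔ z ∈ boundaries k p (sublevel f t)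
  constructor
  · intro h0
    refine h.mem_boundaries_of_coord_eq_zero hf hc hz fun i hi => ?_
    by_contra hne
    have h3 : (i.1.card = p + 1 ∧ pair i = none) ∧ ∀ j, pair j = some i → f.1 i < f.1 j :=
      ⟨⟨((h.eq_of_mem_chains hf hc hz.1).2 i hne).2, h.pair_eq_none_of_mem_cycles hf hc hz hne⟩,
        fun j hj => hi.1.trans_lt (hi.2 j hj)⟩
    have h4 := congrArg Subtype.val (congrFun h0 ⟨i, h3⟩)
    exact hne ((if_pos hi).symm.trans h4)
  · intro hb
    funext i
    apply Subtype.ext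
    classical
    change (if t ∈ (bar i).carrier then c z i.1 else 0) = 0
    split_ifs with ht
    · exact h.coord_eq_zero_of_mem_boundaries hf hc hb ht
    · rfl

theorem barCoord_surjective [Finite K.faces] (h : IsAdaptedBasis r E pair)
    (hf : ∀ i j, r i ≤ r j → f.1 i ≤ f.1 j)
    (hc : ∀ y, c (Finsupp.linearCombination k E y) = y) (p : ℕ) (t : ℝ) :
    Function.Surjective (barCoord c pair f p t) := by
  classical
  have := Fintype.ofFinite (BarIndex pair f.1 p)
  intro a
  have ha : ∀ i, (a i : k) ≠ 0 → t ∈ (bar i).carrier := fun i hi => by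
    by_contra ht
    exact hi (mem_intervalSpace.1 (a i).2 ht)
  have hz : ∑ i, (a i : k) • E i.1 ∈ cycles k p (sublevel f t) := by
    refine Submodule.sum_mem _ fun i _ => ?_
    by_cases hi : (a i : k) = 0
    · rw [hi, zero_smul]
      exact Submodule.zero_mem _
    · refine Submodule.smul_mem _ _ ⟨h.mem_chains_sublevel hf (ha i hi).1 i.2.1.1, ?_⟩
      exact h.boundary_eq_zero i.1 i.2.1.2
  refine ⟨⟨_, hz⟩, ?_⟩
  funext i
  apply Subtype.ext
  change (if t ∈ (bar i).carrier then c (∑ i, (a i : k) • E i.1) i.1 else 0) = a i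
  have hci : c (∑ i, (a i : k) • E i.1) i.1 = a i := by
    rw [map_sum, Finsupp.finsetSum_apply, Finset.sum_eq_single i]
    · rw [map_smul, coord_apply_basis hc]
      simp
    · intro l _ hl
      rw [map_smul, coord_apply_basis hc, Finsupp.smul_apply,
        Finsupp.single_eq_of_ne fun hil => hl (Subtype.ext hil.symm), smul_zero]
    · simp
  rw [hci]
  split_ifs with ht
  · rfl
  · exact (mem_intervalSpace.1 (a i).2 ht).symm

theorem isBarcode (h : IsAdaptedBasis r E pair) (hf : ∀ i j, r i ≤ r j → f.1 i ≤ f.1 j)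
    (p : ℕ) [Finite K.faces] [Fintype (BarIndex pair f.1 p)] :
    IsBarcode (persistentHomology k p f)
      (Finset.univ.val.map (bar : BarIndex pair f.1 p → RealInterval)) := by
  classical
  obtain ⟨c, hc⟩ := h.exists_coord
  refine isBarcode_of_linearEquiv bar (fun t =>
    (Submodule.quotEquivOfEq _ _ (h.ker_barCoord hf hc p t).symm).trans
      ((barCoord c pair f p t).quotKerEquivOfSurjective (h.barCoord_surjective hf hc p t))) ?_
  intro s t hst x i
  induction x using Submodule.Quotient.induction_on with
  | _ z =>
    apply Subtype.ext
    change (if t ∈ (bar i).carrier then c z i.1 else 0) =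
      if t ∈ (bar i).carrier then (if s ∈ (bar i).carrier then c z i.1 else 0) else 0
    by_cases ht : t ∈ (bar i).carrier
    · rw [if_pos ht, if_pos ht]
      split_ifs with hs
      · rfl
      -- Here `t` lies in the bar but `s` does not. A nonzero coefficient means that `i` has entered
      -- by time `s`, and `s ≤ t` precedes the death, so `s` would lie in the bar.
      · by_contra hne
        exact hs ⟨((h.eq_of_mem_chains hf hc z.2.1).2 i.1 hne).1,
          fun j hj => hst.trans_lt (ht.2 j hj)⟩
    · rw [if_neg ht, if_neg ht]

open Classical in
theorem dgm_eq [Fintype K.faces] (h : IsAdaptedBasis r E pair)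
    (hf : ∀ i j, r i ≤ r j → f.1 i ≤ f.1 j) (p : ℕ) :
    dgm k p f = indexedDiagram (Finset.univ.filter fun i : K.faces => i.1.card = p + 1 ∧
      pair i = none) (barPoint pair f.1) := by
  unfold dgm indexedDiagram
  rw [(h.isBarcode hf p).barcode_eq, Multiset.map_map, Finset.filter_filter]
  rw [Multiset.map_congr (f := endpoints ∘ bar) (g := barPoint pair f.1 ∘ Subtype.val) rfl
    fun i _ => h.endpoints_bar i, ← Multiset.map_map (barPoint pair f.1) Subtype.val]
  congr 1
  have : (Finset.univ : Finset (BarIndex pair f.1 p)).map (Function.Embedding.subtype _) =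
      Finset.univ.filter fun i : K.faces => (i.1.card = p + 1 ∧ pair i = none) ∧
        (barPoint pair f.1 i).2 ≠ (barPoint pair f.1 i).1 := by
    ext i
    simp only [h.barPoint_snd_ne_iff hf]
    simp
  exact congrArg Finset.val this

end IsAdaptedBasis

end Pairing

/-! ## Comparison of filter functions that are monotone for a common order -/

section Sorted

variable {ι : Type*} [Finite ι]

/-- Pigeonhole: otherwise `π` would inject the indices of rank at most `r i` into those of rank less
than `r i`, a smaller set because it omits `i`. -/
theorem exists_le_le_of_injective (r : ι → ℝ) {π : ι → ι} (hπ : Function.Injective π) (i : ι) :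
    ∃ l, r l ≤ r i ∧ r i ≤ r (π l) := by
  classical
  have := Fintype.ofFinite ι
  by_contra! hc
  have h1 : (Finset.univ.filter fun l => r l ≤ r i).card ≤
      (Finset.univ.filter fun l => r l < r i).card :=
    Finset.card_le_card_of_injOn π (fun l hl => by simpa using hc l (by simpa using hl))
      hπ.injOn
  refine absurd h1 (not_le.2 (Finset.card_lt_card ⟨fun l hl => ?_, fun hsub => ?_⟩))
  · simp only [Finset.mem_filter, Finset.mem_univ, true_and] at hl ⊢
    exact hl.le
  · have : i ∈ Finset.univ.filter fun l => r l < r i := hsub (by simp)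
    simp at this

/-- Among all matchings of two finite families of reals, the monotone one is optimal. -/
theorem exists_edist_le_of_injective {r f g : ι → ℝ} (hf : ∀ i j, r i ≤ r j → f i ≤ f j)
    (hg : ∀ i j, r i ≤ r j → g i ≤ g j) {π : ι → ι} (hπ : Function.Injective π) (i : ι) :
    ∃ l, edist (f i) (g i) ≤ edist (f l) (g (π l)) := by
  rcases le_total (f i) (g i) with hle | hle
  -- This `l` satisfies `f l ≤ f i ≤ g i ≤ g (π l)`; the other case follows with the reversed rank.
  · obtain ⟨l, h1, h2⟩ := exists_le_le_of_injective r hπ i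
    refine ⟨l, ?_⟩
    rw [edist_dist, edist_dist, Real.dist_eq, Real.dist_eq]
    apply ENNReal.ofReal_le_ofReal
    have := hf _ _ h1
    have := hg _ _ h2
    rw [abs_of_nonpos (by linarith), abs_of_nonpos (by linarith)]
    linarith
  · obtain ⟨l, h1, h2⟩ := exists_le_le_of_injective (fun j => -r j) hπ i
    refine ⟨l, ?_⟩
    rw [edist_dist, edist_dist, Real.dist_eq, Real.dist_eq]
    apply ENNReal.ofReal_le_ofReal
    have := hf _ _ (neg_le_neg_iff.1 h1)
    have := hg _ _ (neg_le_neg_iff.1 h2)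
    rw [abs_of_nonneg (by linarith), abs_of_nonneg (by linarith)]
    linarith

end Sorted

section Comparison

variable {k : Type*} [Field k] {V : Type*} [LinearOrder V] {K : PreAbstractSimplicialComplex V}
  {r : K.faces → ℝ} {E : K.faces → ChainSpace k V} {pair : K.faces → Option K.faces}

theorem edist_fst_le_planeDist (x y : ℝ × WithTop ℝ) : edist x.1 y.1 ≤ planeDist x y :=
  le_max_left _ _

theorem d0_le {V : Type*} {K : PreAbstractSimplicialComplex V} (f : K.faces → ℝ)
    {σ τ : K.faces} (h : σ ≠ τ) : d0 f ≤ edist (f σ) (f τ) / 2 :=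
  ENNReal.div_le_div_right (iInf_le_of_le σ (iInf₂_le τ h)) 2

namespace IsAdaptedBasis

theorem planeDist_barPoint_le [Fintype K.faces] (h : IsAdaptedBasis r E pair)
    (f g : K.faces → ℝ) (i : K.faces) :
    planeDist (barPoint pair f i) (barPoint pair g i) ≤ edist f g := by
  refine max_le (edist_le_pi_edist f g i) ?_
  by_cases hex : ∃ j, pair j = some i
  · obtain ⟨j, hj⟩ := hex
    rw [h.barPoint_of_pair f hj, h.barPoint_of_pair g hj]
    exact edist_le_pi_edist f g j
  · rw [barPoint, barPoint, dif_neg hex, dif_neg hex, extDist_self]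
    exact zero_le

/-- By the triangle inequality through `t`, the gap `|f i - f j|` of a pair is at most twice the
distance to `(t, t)`; this is the origin of the factor `1/2` in `d0`. -/
theorem d0_le_planeDist (h : IsAdaptedBasis r E pair) (f : K.faces → ℝ) (i : K.faces) (t : ℝ) :
    d0 f ≤ planeDist (barPoint pair f i) (t, (t : WithTop ℝ)) := by
  by_cases hex : ∃ j, pair j = some i
  · obtain ⟨j, hj⟩ := hex
    have hij : i ≠ j := by
      rintro rfl
      exact (h.rank_lt _ _ hj).false
    refine (d0_le f hij).trans (ENNReal.div_le_of_le_mul ?_)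
    rw [h.barPoint_of_pair f hj, mul_two]
    refine (edist_triangle_right (f i) (f j) t).trans (add_le_add (le_max_left _ _) ?_)
    exact le_max_right _ _
  · refine le_trans ?_ (le_max_right _ _)
    rw [barPoint, dif_neg hex]
    exact le_top

variable [Fintype K.faces]

theorem maxBottleneckDist_le (h : IsAdaptedBasis r E pair) {f g : FilterFunction K}
    (hf : ∀ i j, r i ≤ r j → f.1 i ≤ f.1 j) (hg : ∀ i j, r i ≤ r j → g.1 i ≤ g.1 j) :
    maxBottleneckDist k f g ≤ edist f.1 g.1 := by
  classical
  refine Finset.sup_le fun p _ => ?_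
  rw [h.dgm_eq hf, h.dgm_eq hg]
  exact bottleneckDist_indexedDiagram_le _ _ _ fun i _ => h.planeDist_barPoint_le _ _ i

/-- Points of all degrees are matched off the diagonal, giving a map `s` on birth simplices. It
extends to death simplices by sending the partner of `i` to the partner of `s i`. First coordinates
control the births, second coordinates the deaths. -/
theorem exists_injective_edist_lt (h : IsAdaptedBasis r E pair) {f g : FilterFunction K}
    (hf : ∀ i j, r i ≤ r j → f.1 i ≤ f.1 j) (hg : ∀ i j, r i ≤ r j → g.1 i ≤ g.1 j) {m : ℝ≥0∞}
    (hm : m ≤ d0 f.1) (hlt : maxBottleneckDist k f g < m) :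
    ∃ π : K.faces → K.faces, Function.Injective π ∧ ∀ i, edist (f.1 i) (g.1 (π i)) < m := by
  classical
  let N : ℕ → Finset K.faces := fun p =>
    Finset.univ.filter fun i : K.faces => i.1.card = p + 1 ∧ pair i = none
  have hN : ∀ p i, i ∈ N p ↔ i.1.card = p + 1 ∧ pair i = none := fun p i => by simp [N]
  have h1 : ∀ p, ∃ π : K.faces → K.faces, Set.InjOn π (N p) ∧ ∀ i ∈ N p, π i ∈ N p ∧
      planeDist (barPoint pair f.1 i) (barPoint pair g.1 (π i)) < m := by
    intro p
    by_cases hp : p ∈ Finset.range (dim K + 1)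
    · have h2 : bottleneckDist (dgm k p f) (dgm k p g) < m :=
        (Finset.le_sup (f := fun p => bottleneckDist (dgm k p f) (dgm k p g)) hp).trans_lt hlt
      rw [h.dgm_eq hf, h.dgm_eq hg] at h2
      exact exists_injOn_of_bottleneckDist_lt (N p) _ _
        (fun i _ t => hm.trans (h.d0_le_planeDist f.1 i t)) h2
    -- Above the dimension of `K` there are no indices to match.
    · have h2 : ∀ i, i ∉ N p := fun i hi => by
        have h3 : i.1.card - 1 ≤ dim K :=
          Finset.le_sup (f := fun σ : K.faces => σ.1.card - 1) (Finset.mem_univ i)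
        have h4 := ((hN p i).1 hi).1
        rw [Finset.mem_range] at hp
        omega
      exact ⟨id, Set.injOn_id _, fun i hi => absurd hi (h2 i)⟩
  choose π hinj hπ using h1
  let s : K.faces → K.faces := fun i => π (i.1.card - 1) i
  have hcard : ∀ i : K.faces, i.1.card = i.1.card - 1 + 1 := fun i => by
    have := Finset.card_pos.2 (K.isRelLowerSet_faces i.2).1
    omega
  have hs : ∀ i, pair i = none → ((s i).1.card = i.1.card ∧ pair (s i) = none) ∧
      planeDist (barPoint pair f.1 i) (barPoint pair g.1 (s i)) < m := by
    intro i hi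
    have h2 := hπ (i.1.card - 1) i ((hN _ _).2 ⟨hcard i, hi⟩)
    rw [hN, ← hcard] at h2
    exact h2
  have hsinj : ∀ i j, pair i = none → pair j = none → s i = s j → i = j := by
    intro i j hi hj hij
    have hc : i.1.card = j.1.card := by rw [← (hs i hi).1.1, ← (hs j hj).1.1, hij]
    refine hinj (i.1.card - 1) ((hN _ _).2 ⟨hcard i, hi⟩)
      ((hN _ _).2 ⟨hc ▸ hcard j, hj⟩) (hij.trans ?_)
    change π (j.1.card - 1) j = _
    rw [hc]
  have h5 : ∀ j, ∃ j', (pair j = none → j' = s j) ∧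
      (∀ i, pair j = some i → pair j' = some (s i)) ∧ edist (f.1 j) (g.1 j') < m := by
    intro j
    rcases hj : pair j with _ | i
    · exact ⟨s j, fun _ => rfl, fun i hi => by simp at hi,
        (edist_fst_le_planeDist _ _).trans_lt (hs j hj).2⟩
    · obtain ⟨-, h6⟩ := hs i (h.pair_eq_none j i hj)
      have h7 := (le_max_right _ _).trans_lt h6
      by_cases hex : ∃ j', pair j' = some (s i)
      · obtain ⟨j', hj'⟩ := hex
        rw [h.barPoint_of_pair _ hj, h.barPoint_of_pair _ hj'] at h7
        refine ⟨j', fun h0 => by simp at h0, fun i' hi' => ?_, h7⟩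
        obtain rfl : i = i' := Option.some_injective _ hi'
        exact hj'
      -- A finite death cannot be matched with an infinite one, since the displacement would be
      -- infinite.
      · rw [h.barPoint_of_pair _ hj, barPoint, dif_neg hex] at h7
        exact absurd h7 not_top_lt
  choose ρ hρ₁ hρ₂ hρ₃ using h5
  refine ⟨ρ, fun a b hab => ?_, hρ₃⟩
  -- Births map to births and deaths to deaths, so the mixed cases cannot occur.
  rcases ha : pair a with _ | i <;> rcases hb : pair b with _ | j
  · exact hsinj a b ha hb (by rw [← hρ₁ a ha, ← hρ₁ b hb, hab])
  · have h6 := hρ₂ b j hb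
    rw [← hab, hρ₁ a ha, (hs a ha).1.2] at h6
    simp at h6
  · have h6 := hρ₂ a i ha
    rw [hab, hρ₁ b hb, (hs b hb).1.2] at h6
    simp at h6
  · have h6 := (hρ₂ a i ha).symm.trans ((congrArg pair hab).trans (hρ₂ b j hb))
    have h7 := hsinj i j (h.pair_eq_none a i ha) (h.pair_eq_none b j hb)
      (Option.some_injective _ h6)
    exact h.inj a b i ha (h7 ▸ hb)

theorem min_edist_d0_le (h : IsAdaptedBasis r E pair) {f g : FilterFunction K}
    (hf : ∀ i j, r i ≤ r j → f.1 i ≤ f.1 j) (hg : ∀ i j, r i ≤ r j → g.1 i ≤ g.1 j) :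
    min (edist f.1 g.1) (d0 f.1) ≤ maxBottleneckDist k f g := by
  by_contra! hlt
  obtain ⟨π, hπ, hlt'⟩ := h.exists_injective_edist_lt hf hg (min_le_right _ _) hlt
  -- Positivity is needed for a strict bound on a supremum over a possibly empty set of simplices.
  have hpos : (0 : ℝ≥0∞) < edist f.1 g.1 := hlt.trans_le' zero_le |>.trans_le (min_le_left _ _)
  refine lt_irrefl (edist f.1 g.1) ?_
  conv_lhs => rw [edist_pi_def]
  rw [Finset.sup_lt_iff hpos]
  intro i _
  obtain ⟨l, hl⟩ := exists_edist_le_of_injective hf hg hπ i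
  exact hl.trans_lt ((hlt' l).trans_le (min_le_left _ _))

end IsAdaptedBasis

theorem maxBottleneckDist_comm (k : Type*) [Field k] [Fintype K.faces] (f g : FilterFunction K) :
    maxBottleneckDist k f g = maxBottleneckDist k g f :=
  Finset.sup_congr rfl fun _ _ => bottleneckDist_comm _ _

end Comparison

/-! ## Top-dimensional strata -/

section Strata

variable {V : Type*} {K : PreAbstractSimplicialComplex V}

/-- A tie `f σ = f τ` is shared by the whole class, which then lies in a hyperplane. -/
theorem injective_of_isTopDimensional [Fintype K.faces] {f : FilterFunction K}
    (h : IsTopDimensional (orderingClass f)) : Function.Injective f.1 := by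
  classical
  intro σ τ hστ
  by_contra hne
  let l : (K.faces → ℝ) →ₗ[ℝ] ℝ :=
    LinearMap.proj (R := ℝ) (φ := fun _ : K.faces => ℝ) σ - LinearMap.proj τ
  have htop : vectorSpan ℝ (orderingClass f) = ⊤ :=
    Submodule.eq_top_of_finrank_eq (h.trans (Module.finrank_fintype_fun_eq_card ℝ).symm)
  have hle : vectorSpan ℝ (orderingClass f) ≤ LinearMap.ker l := by
    refine Submodule.span_le.2 ?_
    rintro _ ⟨a, ha, b, hb, rfl⟩
    have heq : ∀ g ∈ orderingClass f, g σ = g τ := fun g hg =>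
      le_antisymm ((hg.2 _ _).2 hστ.le) ((hg.2 _ _).2 hστ.ge)
    simp [l, heq a ha, heq b hb]
  have hmem : Pi.single σ (1 : ℝ) ∈ LinearMap.ker l := hle (htop ▸ Submodule.mem_top)
  simp [l, Pi.single_eq_of_ne (Ne.symm hne)] at hmem

theorem le_of_mem_closure_orderingClass {f : FilterFunction K} {g : K.faces → ℝ}
    (hg : g ∈ closure (orderingClass f)) (σ τ : K.faces) (h : f.1 σ ≤ f.1 τ) : g σ ≤ g τ :=
  closure_minimal (t := {g : K.faces → ℝ | g σ ≤ g τ}) (fun _ hg' => (hg'.2 σ τ).2 h)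
    (isClosed_le (continuous_apply σ) (continuous_apply τ)) hg

theorem le_of_edist_le {a b a' b' : ℝ} (hab : a ≤ b) (h₁ : edist a a' ≤ edist a b / 2)
    (h₂ : edist b b' ≤ edist a b / 2) : a' ≤ b' := by
  have h2 : edist a b / 2 = ENNReal.ofReal ((b - a) / 2) := by
    rw [edist_dist, dist_comm, Real.dist_eq, abs_of_nonneg (sub_nonneg.2 hab),
      ENNReal.ofReal_div_of_pos two_pos, ENNReal.ofReal_ofNat]
  have hnn : 0 ≤ (b - a) / 2 := by linarith
  rw [h2, edist_dist, ENNReal.ofReal_le_ofReal_iff hnn, Real.dist_eq, abs_le] at h₁ h₂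
  linarith [h₁.1, h₂.2]

variable [Fintype K.faces]

theorem le_of_edist_le_d0 {f g : K.faces → ℝ} (h : edist f g ≤ d0 f) {σ τ : K.faces}
    (hle : f σ ≤ f τ) : g σ ≤ g τ := by
  by_cases hst : σ = τ
  · rw [hst]
  · exact le_of_edist_le hle ((edist_le_pi_edist f g σ).trans (h.trans (d0_le f hst)))
      ((edist_le_pi_edist f g τ).trans (h.trans (d0_le f hst)))

/-- If `δ` is the gap of `f` at two simplices, then `g` and `h` are within `δ / 6` of `f`. So `‖g -
h‖ ≤ δ / 3`, while the gap of `g` is at least `δ - 2 * (δ / 6)`, half of which is `δ / 3`. -/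
theorem edist_le_d0_of_le_third {f g h : K.faces → ℝ} (hg : edist f g ≤ d0 f / 3)
    (hh : edist f h ≤ d0 f / 3) : edist g h ≤ d0 g := by
  unfold d0
  rw [ENNReal.le_div_iff_mul_le (Or.inl two_ne_zero) (Or.inl ENNReal.ofNat_ne_top)]
  refine le_iInf fun σ => le_iInf₂ fun τ hst => ?_
  have h3 : d0 f / 3 ≤ ENNReal.ofReal (dist (f σ) (f τ) / 6) := by
    refine (ENNReal.div_le_div_right (d0_le f hst) 3).trans (le_of_eq ?_)
    rw [edist_dist, ← ENNReal.ofReal_ofNat 2, ← ENNReal.ofReal_ofNat 3,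
      ← ENNReal.ofReal_div_of_pos two_pos, ← ENNReal.ofReal_div_of_pos three_pos]
    congr 1
    ring
  have hnn : 0 ≤ dist (f σ) (f τ) / 6 := by positivity
  replace hg := hg.trans h3
  replace hh := hh.trans h3
  rw [edist_dist, ENNReal.ofReal_le_ofReal_iff hnn] at hg hh
  rw [edist_dist, edist_dist, ← ENNReal.ofReal_ofNat 2, ← ENNReal.ofReal_mul dist_nonneg]
  apply ENNReal.ofReal_le_ofReal
  have h4 := dist_triangle_left g h f
  have h5 := dist_le_pi_dist f g σ
  have h6 := dist_le_pi_dist f g τ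
  have h7 := dist_triangle4 (f σ) (g σ) (g τ) (f τ)
  rw [dist_comm (g τ)] at h7
  linarith

end Strata

end Persistence

theorem mainTheorem7 {k : Type*} [Field k] {V : Type*} [LinearOrder V]
    (K : PreAbstractSimplicialComplex V) [Fintype K.faces] :
    (∀ S ∈ Persistence.orderingStrata K, Persistence.IsTopDimensional S →
      ∀ f g : Persistence.FilterFunction K, f.1 ∈ closure S → g.1 ∈ closure S →
        min ‖f.1 - g.1‖ₑ (max (Persistence.d0 f.1) (Persistence.d0 g.1)) ≤
          Persistence.maxBottleneckDist k f g) ∧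
    (∀ S ∈ Persistence.orderingStrata K, Persistence.IsTopDimensional S →
      ∀ f : Persistence.FilterFunction K, f.1 ∈ S →
        (∀ g : K.faces → ℝ, ‖f.1 - g‖ₑ ≤ Persistence.d0 f.1 →
          ∃ hg : Persistence.IsFilterFunction g,
            Persistence.maxBottleneckDist k f ⟨g, hg⟩ = ‖f.1 - g‖ₑ) ∧
        (∀ g h : K.faces → ℝ,
          max ‖f.1 - g‖ₑ ‖f.1 - h‖ₑ ≤ Persistence.d0 f.1 / 3 →
          ∃ (hg : Persistence.IsFilterFunction g) (hh : Persistence.IsFilterFunction h),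
            Persistence.maxBottleneckDist k ⟨g, hg⟩ ⟨h, hh⟩ = ‖g - h‖ₑ)) := by
  simp only [← edist_eq_enorm_sub]
  constructor
  · rintro _ ⟨f₀, rfl⟩ htop f g hf hg
    obtain ⟨E, pair, hE⟩ := Persistence.exists_isAdaptedBasis k
      (Persistence.injective_of_isTopDimensional htop) f₀.2
    have hf' := Persistence.le_of_mem_closure_orderingClass hf
    have hg' := Persistence.le_of_mem_closure_orderingClass hg
    -- The maximum splits into the bounds with `d0 f` and with `d0 g`, the second being the first
    -- with `f` and `g` exchanged.
    rw [min_max_distrib_left]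
    refine max_le (hE.min_edist_d0_le hf' hg') ?_
    rw [edist_comm, Persistence.maxBottleneckDist_comm]
    exact hE.min_edist_d0_le hg' hf'
  · rintro _ ⟨f₀, rfl⟩ htop f hf
    obtain ⟨E, pair, hE⟩ := Persistence.exists_isAdaptedBasis k
      (Persistence.injective_of_isTopDimensional htop) f₀.2
    have hf' : ∀ σ τ, f₀.1 σ ≤ f₀.1 τ → f.1 σ ≤ f.1 τ := fun σ τ => (hf.2 σ τ).2
    have hfilt : ∀ g : K.faces → ℝ, edist f.1 g ≤ Persistence.d0 f.1 →
        Persistence.IsFilterFunction g := fun g hg σ τ hst =>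
      Persistence.le_of_edist_le_d0 hg (f.2 σ τ hst)
    -- Functions in the ball remain weakly monotone for the order of `f₀`, so the same adapted basis
    -- computes their diagrams.
    have hcomp : ∀ g : K.faces → ℝ, edist f.1 g ≤ Persistence.d0 f.1 →
        ∀ σ τ, f₀.1 σ ≤ f₀.1 τ → g σ ≤ g τ := fun g hg σ τ hst =>
      Persistence.le_of_edist_le_d0 hg (hf' σ τ hst)
    constructor
    · intro g hg
      refine ⟨hfilt g hg, le_antisymm (hE.maxBottleneckDist_le hf' (hcomp g hg)) ?_⟩
      have := hE.min_edist_d0_le (g := ⟨g, hfilt g hg⟩) hf' (hcomp g hg)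
      rwa [min_eq_left hg] at this
    · intro g h hgh
      have hthird : Persistence.d0 f.1 / 3 ≤ Persistence.d0 f.1 :=
        ENNReal.div_le_of_le_mul (le_mul_of_one_le_right zero_le (by norm_num))
      have hg := (le_max_left _ _).trans hgh
      have hh := (le_max_right _ _).trans hgh
      have hg' := hg.trans hthird
      have hh' := hh.trans hthird
      refine ⟨hfilt g hg', hfilt h hh',
        le_antisymm (hE.maxBottleneckDist_le (hcomp g hg') (hcomp h hh')) ?_⟩
      -- The lower bound is centred at `g`, whose own `d0` dominates `‖g - h‖`.
      have := hE.min_edist_d0_le (f := ⟨g, hfilt g hg'⟩) (g := ⟨h, hfilt h hh'⟩)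
        (hcomp g hg') (hcomp h hh')
      rwa [min_eq_left (Persistence.edist_le_d0_of_le_third hg hh)] at this
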